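/- **Theorem (Approximate solutions of the optimal transport problem with independent marginals).** For $K,L\ge 1$ let $\mu=\otimes_{k=1}^K\mu_k$ with $\mu_k=\sum_{l=1}^L\mu_k^l\,\delta_{x_k^l}$ be a product of $K$ univariate discrete probability distributions, let $\nu_t=t\,\delta_{y_1}+(1-t)\,\delta_{y_2}$ with $y_1,y_2\in\mathbb Q^K$ and $t\in[0,1]$, and let $\varepsilon>0$ be a rational error tolerance. For the cost $c(x,y)=\|x-y\|^2$ (squared Euclidean distance) let $$W_c(\mu,\nu_t)=\min\Big\{\sum_{i}\sum_{j=1}^{2}c(x_i,y_j)\,\pi_{ij}\;:\;\pi\ge 0,\ \sum_j\pi_{ij}=\mu_i\ \forall i,\ \sum_i\pi_{i1}=t,\ \sum_i\pi_{i2}=1-t\Big\},$$ where $i$ runs over the $L^K$ atoms $x_i=(x_1^{i_1},\dots,x_K^{i_K})$ of $\mu$, of probability $\mu_i=\prod_k\mu_k^{i_k}$. Suppose that all probabilities $\mu_k^l,t,1-t$ and all coordinates $x_k^l,y_{1,k},y_{2,k}$ are fractions of two integers with absolute values at most $U\in\mathbb N$. There is one algorithm (a fixed program, independent of the instance, of a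 random access machine over $\mathbb Q$ whose operations are addition, subtraction, multiplication, division, rounding down to an integer, comparison, assignment and array access) that, given $K,L,(\mu_k^l),(x_k^l),y_1,y_2,t,\varepsilon$, outputs a number $\widetilde W$ with $|\widetilde W-W_c(\mu,\nu_t)|\le\varepsilon$ and for which the following bounds hold. 1. The number of operations is $$\mathcal O\big(KL\log_2(KL)+K^6U^8/\varepsilon^4+1\big),$$ with an absolute implied constant. 2. The bit lengths of all numbers computed by the algorithm are bounded by a fixed polynomial in $K$, $L$, $\log_2 U$ and $\max\{0,\log_2(1/\varepsilon)\}$. -/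

import Mathlib

/-! ### Optimal transport between finitely supported distributions -/

/-- The transport polytope `Π(μ, ν)`: nonnegative matrices with row sums `μ` and column sums `ν`. -/
def transportPlans {I J : Type*} [Fintype I] [Fintype J] (μ : I → ℝ) (ν : J → ℝ) :
    Set (I → J → ℝ) :=
  {π | (∀ i j, 0 ≤ π i j) ∧ (∀ i, ∑ j, π i j = μ i) ∧ (∀ j, ∑ i, π i j = ν j)}

/-- The optimal transport distance `W_c(μ, ν)` between `μ = ∑ i, μ i • δ_{x i}` and
`ν = ∑ j, ν j • δ_{y j}`: the optimal value of the transportation linear program. -/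
noncomputable def optimalTransport {E I J : Type*} [Fintype I] [Fintype J] (c : E → E → ℝ)
    (μ : I → ℝ) (x : I → E) (ν : J → ℝ) (y : J → E) : ℝ :=
  sInf ((fun π : I → J → ℝ => ∑ i, ∑ j, c (x i) (y j) * π i j) '' transportPlans μ ν)

/-- The rational vector `v`, seen as a point of the Euclidean space `ℝ^K`. -/
noncomputable def ratPoint {K : ℕ} (v : Fin K → ℚ) : EuclideanSpace ℝ (Fin K) :=
  WithLp.toLp 2 (fun k => (v k : ℝ))

/-- `W_c(μ, ν_t)` for the squared Euclidean cost, where `μ` is the product of the `K` univariate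
marginals `μ_k = ∑ l, p k l • δ_{x k l}` and `ν_t = t • δ_{y₁} + (1 - t) • δ_{y₂}`. The atoms of `μ`
are indexed by the `L ^ K` maps `i : Fin K → Fin L`. -/
noncomputable def productTwoPointOT {K L : ℕ} (p x : Fin K → Fin L → ℚ) (y₁ y₂ : Fin K → ℚ)
    (t : ℚ) : ℝ :=
  optimalTransport (fun u v : EuclideanSpace ℝ (Fin K) => ‖u - v‖ ^ 2)
    (fun i : Fin K → Fin L => ∏ k, (p k (i k) : ℝ))
    (fun i : Fin K → Fin L => ratPoint (fun k => x k (i k)))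
    ![(t : ℝ), 1 - (t : ℝ)]
    ![ratPoint y₁, ratPoint y₂]

/-! ### Sizes of rational numbers -/

/-- `q` is a fraction of two integers with absolute values at most `U`. -/
def IsFractionBoundedBy (U : ℕ) (q : ℚ) : Prop :=
  ∃ a b : ℤ, b ≠ 0 ∧ |a| ≤ (U : ℤ) ∧ |b| ≤ (U : ℤ) ∧ q = (a : ℚ) / (b : ℚ)

/-- Number of binary digits of numerator and denominator of `q` in lowest terms. -/
def bitLength (q : ℚ) : ℕ := q.num.natAbs.size + q.den.size

/-! ### A random access machine over the rational numbers

The memory consists of registers `r 0, r 1, …` and arrays `A 0, A 1, …`, each cell of which holds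
one rational number. A program is a fixed finite text: it can depend neither on the size nor
on the data of the instance it is run on. -/

namespace RatRam

/-- A memory configuration: contents of the registers and of the cells of the arrays. -/
structure State where
  reg : ℕ → ℚ
  arr : ℕ → ℕ → ℚ

/-- Memory after writing `q` to register `r`. -/
def State.setReg (s : State) (r : ℕ) (q : ℚ) : State where
  reg := Function.update s.reg r q
  arr := s.arr

/-- Memory after writing `q` to cell `n` of array `a`. -/
def State.setCell (s : State) (a n : ℕ) (q : ℚ) : State where
  reg := s.reg
  arr := Function.update s.arr a (Function.update (s.arr a) n q)

/-- The four binary arithmetic operations (with the convention `a / 0 = 0`). -/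
inductive BinOp
  | add
  | sub
  | mul
  | div

/-- The result of a binary arithmetic operation. -/
def BinOp.apply : BinOp → ℚ → ℚ → ℚ
  | .add, a, b => a + b
  | .sub, a, b => a - b
  | .mul, a, b => a * b
  | .div, a, b => a / b

/-- Expressions: rational literals, registers, array cells `A a [e]`, arithmetic operations, and
rounding down to an integer. -/
inductive Term
  | const (q : ℚ)
  | reg (r : ℕ)
  | cell (a : ℕ) (e : Term)
  | bin (o : BinOp) (e f : Term)
  | floor (e : Term)

/-- The value of an expression. The address of an array cell is meant to be a natural number;
other values are rounded down (negative ones to `0`). -/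
def Term.eval (s : State) : Term → ℚ
  | .const q => q
  | .reg r => s.reg r
  | .cell a e => s.arr a ⌊e.eval s⌋₊
  | .bin o e f => o.apply (e.eval s) (f.eval s)
  | .floor e => (⌊e.eval s⌋ : ℚ)

/-- The number of operations (array accesses, arithmetic operations, roundings) in the evaluation of
an expression. -/
def Term.cost : Term → ℕ
  | .const _ => 0
  | .reg _ => 0
  | .cell _ e => e.cost + 1
  | .bin _ e f => e.cost + f.cost + 1
  | .floor e => e.cost + 1

/-- The results of all arithmetic operations and roundings in the evaluation of an expression. -/
def Term.computed (s : State) : Term → List ℚ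
  | .const _ => []
  | .reg _ => []
  | .cell _ e => e.computed s
  | .bin o e f => e.computed s ++ f.computed s ++ [o.apply (e.eval s) (f.eval s)]
  | .floor e => e.computed s ++ [(⌊e.eval s⌋ : ℚ)]

/-- Programs: `assign r e` is `r := e`; `store a i e` is `A a [i] := e`; `branch e f c d` is
`if e < f then c else d`; `loop e f c` is `while e < f do c`. -/
inductive Program
  | skip
  | assign (r : ℕ) (e : Term)
  | store (a : ℕ) (i e : Term)
  | seq (c d : Program)
  | branch (e f : Term) (c d : Program)
  | loop (e f : Term) (c : Program)

/-- `Run c s n T s'`: started in memory `s`, the program `c` halts in memory `s'` after exactly `n`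
operations (arithmetic operations, roundings, array accesses, assignments and comparisons all
count), and `T` lists all numbers that it computes (results of operations) or writes to memory. -/
inductive Run : Program → State → ℕ → List ℚ → State → Prop
  | skip (s : State) : Run .skip s 0 [] s
  | assign (r : ℕ) (e : Term) (s : State) :
      Run (.assign r e) s (e.cost + 1) (e.computed s ++ [e.eval s])
        (s.setReg r (e.eval s))
  | store (a : ℕ) (i e : Term) (s : State) :
      Run (.store a i e) s (i.cost + e.cost + 1) (i.computed s ++ e.computed s ++ [e.eval s])
        (s.setCell a ⌊i.eval s⌋₊ (e.eval s))
  | seq {c d : Program} {s s' s'' : State} {m n : ℕ} {T T' : List ℚ}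
      (hc : Run c s m T s') (hd : Run d s' n T' s'') :
      Run (.seq c d) s (m + n) (T ++ T') s''
  | branch_true {e f : Term} {c d : Program} {s s' : State} {n : ℕ} {T : List ℚ}
      (h : e.eval s < f.eval s) (hc : Run c s n T s') :
      Run (.branch e f c d) s (e.cost + f.cost + 1 + n) (e.computed s ++ f.computed s ++ T) s'
  | branch_false {e f : Term} {c d : Program} {s s' : State} {n : ℕ} {T : List ℚ}
      (h : ¬ e.eval s < f.eval s) (hd : Run d s n T s') :
      Run (.branch e f c d) s (e.cost + f.cost + 1 + n) (e.computed s ++ f.computed s ++ T) s'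
  | loop_true {e f : Term} {c : Program} {s s' s'' : State} {m n : ℕ} {T T' : List ℚ}
      (h : e.eval s < f.eval s) (hc : Run c s m T s') (hl : Run (.loop e f c) s' n T' s'') :
      Run (.loop e f c) s (e.cost + f.cost + 1 + m + n)
        (e.computed s ++ f.computed s ++ T ++ T') s''
  | loop_false {e f : Term} {c : Program} {s : State}
      (h : ¬ e.eval s < f.eval s) :
      Run (.loop e f c) s (e.cost + f.cost + 1) (e.computed s ++ f.computed s) s

/-- The memory holding an instance: registers `0, 1, 2, 3` hold `K, L, t, ε`; the cells `k * L + l` of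
the arrays `0` and `1` hold `p k l` and `x k l`; the cells `k` of the arrays `2` and `3` hold `y₁ k` and
`y₂ k` (indices counted from `0`). Everything else is `0`. -/
def inputState {K L : ℕ} (p x : Fin K → Fin L → ℚ) (y₁ y₂ : Fin K → ℚ) (t ε : ℚ) : State where
  reg r :=
    match r with
    | 0 => (K : ℚ)
    | 1 => (L : ℚ)
    | 2 => t
    | 3 => ε
    | _ => 0
  arr a n :=
    match a with
    | 0 => if h : n < K * L then
        p (finProdFinEquiv.symm ⟨n, h⟩).1 (finProdFinEquiv.symm ⟨n, h⟩).2 else 0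
    | 1 => if h : n < K * L then
        x (finProdFinEquiv.symm ⟨n, h⟩).1 (finProdFinEquiv.symm ⟨n, h⟩).2 else 0
    | 2 => if h : n < K then y₁ ⟨n, h⟩ else 0
    | 3 => if h : n < K then y₂ ⟨n, h⟩ else 0
    | _ => 0

/-- The output of a halted computation is the content of register `4`. -/
def State.output (s : State) : ℚ := s.reg 4

end RatRam

/-!
A transport plan from `μ` to `ν_t` is determined by the masses `φ i ∈ [0, μ i]`, of total mass `t`,
that it sends to `y₁`. Its cost is the mean cost of sending everything to `y₂` plus the sum of
`φ i * gap i`, where `gap i = ‖x i - y₁‖ ^ 2 - ‖x i - y₂‖ ^ 2` is a sum of `K` terms, one for each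
coordinate. Let `V` (`scale` below) bound all these terms, and round each of them down to one of
`2 * N + 1` equidistant points of `[-V, V]`. This changes the optimal value by at most `K * V / N`,
and the gap of an atom becomes an affine function of a sum `S` of `K` integers between `0` and
`2 * N`, which are independent under `μ`. It is then optimal to fill up the mass `t` with the atoms
of smallest `S`, and the resulting cost depends only on the distribution of `S`: by a layer-cake
formula, the optimal value of the sum of `φ i * S i` is
`2 * N * K * t - ∑ s < 2 * N * K, min t (P (S ≤ s))`. The distribution of `S` is computed by `K`
convolutions, at a cost of order `K ^ 2 * N ^ 2`.

The coarsest admissible power of two `N` is of order `K * V / ε = O (K * U ^ 2 / ε)`. No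
intermediate number is long, because every probability that occurs is a multiple of the inverse of
the product of the denominators of all `p k l`.
-/

/-! ### Bit lengths -/

theorem isFractionBoundedBy_iff {U : ℕ} {q : ℚ} :
    IsFractionBoundedBy U q ↔ q.num.natAbs ≤ U ∧ q.den ≤ U := by
  constructor
  · rintro ⟨a, b, hb, ha, hbU, rfl⟩
    have hden : ((a / b : ℚ).den : ℤ) ∣ b := by simpa [Rat.divInt_eq_div] using Rat.den_dvd a b
    have hnum : (a / b : ℚ).num ∣ a := by simpa [Rat.divInt_eq_div] using Rat.num_dvd a hb
    refine ⟨?_, by exact_mod_cast (Int.le_of_dvd (abs_pos.2 hb) ((dvd_abs _ _).2 hden)).trans hbU⟩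
    rcases eq_or_ne a 0 with rfl | ha0
    · simp
    · have := (Int.le_of_dvd (abs_pos.2 ha0) ((dvd_abs _ _).2 ((abs_dvd _ _).2 hnum))).trans ha
      rw [Int.abs_eq_natAbs] at this
      exact_mod_cast this
  · rintro ⟨hnum, hden⟩
    exact ⟨q.num, q.den, by exact_mod_cast q.den_ne_zero,
      by rw [Int.abs_eq_natAbs]; exact_mod_cast hnum, by simpa using hden,
      (Rat.num_div_den q).symm⟩

namespace IsFractionBoundedBy

variable {M N : ℕ} {q r : ℚ}

theorem mono (h : IsFractionBoundedBy M q) (hMN : M ≤ N) : IsFractionBoundedBy N q := by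
  rw [isFractionBoundedBy_iff] at h ⊢
  exact ⟨h.1.trans hMN, h.2.trans hMN⟩

theorem one_le (h : IsFractionBoundedBy M q) : 1 ≤ M :=
  q.den_pos.trans_le (isFractionBoundedBy_iff.1 h).2

theorem abs_le (h : IsFractionBoundedBy M q) : |q| ≤ M := by
  have hden : (1 : ℚ) ≤ q.den := by exact_mod_cast q.den_pos
  calc |q| = |(q.num : ℚ)| / q.den := by
        conv_lhs => rw [← Rat.num_div_den q, abs_div, Nat.abs_cast]
    _ ≤ |(q.num : ℚ)| := div_le_self (abs_nonneg _) hden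
    _ ≤ M := by
        rw [← Int.cast_abs, Int.abs_eq_natAbs]
        exact_mod_cast (isFractionBoundedBy_iff.1 h).1

theorem natCast {n : ℕ} (hM : 1 ≤ M) (hn : n ≤ M) : IsFractionBoundedBy M (n : ℚ) :=
  isFractionBoundedBy_iff.2 ⟨by simpa using hn, by simpa using hM⟩

theorem zero (hM : 1 ≤ M) : IsFractionBoundedBy M 0 :=
  natCast hM (Nat.zero_le _)

theorem add (hq : IsFractionBoundedBy M q) (hr : IsFractionBoundedBy N r) :
    IsFractionBoundedBy (2 * (M * N)) (q + r) := by
  obtain ⟨a, b, hb, haM, hbM, rfl⟩ := hq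
  obtain ⟨c, d, hd, hcN, hdN, rfl⟩ := hr
  have had : |a * d| ≤ M * N := (abs_mul a d).trans_le (by gcongr)
  have hbc : |b * c| ≤ M * N := (abs_mul b c).trans_le (by gcongr)
  have hbd : |b * d| ≤ M * N := (abs_mul b d).trans_le (by gcongr)
  refine ⟨a * d + b * c, b * d, mul_ne_zero hb hd, ?_, ?_, ?_⟩
  · push_cast
    linarith [abs_add_le (a * d) (b * c)]
  · push_cast
    linarith [abs_nonneg (b * d)]
  · push_cast
    exact div_add_div _ _ (by exact_mod_cast hb) (by exact_mod_cast hd)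

theorem neg (hq : IsFractionBoundedBy M q) : IsFractionBoundedBy M (-q) := by
  simpa [isFractionBoundedBy_iff] using hq

theorem sub (hq : IsFractionBoundedBy M q) (hr : IsFractionBoundedBy N r) :
    IsFractionBoundedBy (2 * (M * N)) (q - r) := by
  simpa [sub_eq_add_neg] using hq.add hr.neg

theorem mul (hq : IsFractionBoundedBy M q) (hr : IsFractionBoundedBy N r) :
    IsFractionBoundedBy (M * N) (q * r) := by
  obtain ⟨a, b, hb, haM, hbM, rfl⟩ := hq
  obtain ⟨c, d, hd, hcN, hdN, rfl⟩ := hr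
  refine ⟨a * c, b * d, mul_ne_zero hb hd, ?_, ?_, by push_cast; exact div_mul_div_comm _ _ _ _⟩
  · rw [abs_mul]
    push_cast
    gcongr
  · rw [abs_mul]
    push_cast
    gcongr

theorem inv (hq : IsFractionBoundedBy M q) : IsFractionBoundedBy M q⁻¹ := by
  obtain rfl | hq0 := eq_or_ne q 0
  · simpa using hq
  obtain ⟨a, b, -, haM, hbM, rfl⟩ := hq
  exact ⟨b, a, by rintro rfl; simp at hq0, hbM, haM, inv_div _ _⟩

theorem div (hq : IsFractionBoundedBy M q) (hr : IsFractionBoundedBy N r) :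
    IsFractionBoundedBy (M * N) (q / r) := by
  simpa [div_eq_mul_inv] using hq.mul hr.inv

end IsFractionBoundedBy

/-- `q` is a fraction of two integers of at most about `b` bits: all bit lengths in the analysis of
the algorithm are controlled by this predicate, which behaves additively under products. -/
def FitsBits (b : ℕ) (q : ℚ) : Prop :=
  IsFractionBoundedBy (2 ^ b) q

namespace FitsBits

variable {a b : ℕ} {q r : ℚ}

theorem mono (h : FitsBits a q) (hab : a ≤ b) : FitsBits b q :=
  IsFractionBoundedBy.mono h (Nat.pow_le_pow_right two_pos hab)

theorem bitLength_le (h : FitsBits b q) : bitLength q ≤ 2 * b + 2 := by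
  obtain ⟨hnum, hden⟩ := isFractionBoundedBy_iff.1 h
  have hlt : 2 ^ b < 2 ^ (b + 1) := Nat.pow_lt_pow_right one_lt_two b.lt_succ_self
  have := Nat.size_le.2 (hnum.trans_lt hlt)
  have := Nat.size_le.2 (hden.trans_lt hlt)
  unfold bitLength
  omega

theorem natCast {n : ℕ} (hn : n ≤ 2 ^ b) : FitsBits b (n : ℚ) :=
  IsFractionBoundedBy.natCast Nat.one_le_two_pow hn

theorem zero : FitsBits b 0 :=
  natCast (Nat.zero_le _)

theorem one : FitsBits b 1 := by
  simpa using natCast (n := 1) (b := b) Nat.one_le_two_pow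

theorem add (hq : FitsBits a q) (hr : FitsBits b r) : FitsBits (a + b + 1) (q + r) :=
  (IsFractionBoundedBy.add hq hr).mono (by rw [pow_succ, pow_add, mul_comm])

theorem sub (hq : FitsBits a q) (hr : FitsBits b r) : FitsBits (a + b + 1) (q - r) :=
  (IsFractionBoundedBy.sub hq hr).mono (by rw [pow_succ, pow_add, mul_comm])

theorem mul (hq : FitsBits a q) (hr : FitsBits b r) : FitsBits (a + b) (q * r) :=
  (IsFractionBoundedBy.mul hq hr).mono (by rw [pow_add])

theorem div (hq : FitsBits a q) (hr : FitsBits b r) : FitsBits (a + b) (q / r) :=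
  (IsFractionBoundedBy.div hq hr).mono (by rw [pow_add])

theorem sum {ι : Type*} {f : ι → ℚ} {s : Finset ι} (hf : ∀ i ∈ s, FitsBits a (f i)) :
    FitsBits (s.card * (a + 1)) (∑ i ∈ s, f i) := by
  classical
  induction s using Finset.induction_on with
  | empty => simpa using zero
  | insert i s hi ih =>
    rw [Finset.sum_insert hi, Finset.card_insert_of_notMem hi]
    rw [Finset.forall_mem_insert] at hf
    exact (hf.1.add (ih hf.2)).mono (by rw [Nat.succ_mul]; omega)

/-- Partial sums of probabilities are of this kind: their common denominator stays short although
they have very many terms. -/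
theorem of_den_dvd {d : ℕ} (hd : 0 < d) (hda : d ≤ 2 ^ a) (hqd : q.den ∣ d)
    (hq : |q| ≤ 2 ^ b) : FitsBits (a + b) q := by
  have hden : q.den ≤ 2 ^ a := (Nat.le_of_dvd hd hqd).trans hda
  have hnum : |(q.num : ℚ)| ≤ 2 ^ (a + b) := by
    rw [← Rat.mul_den_eq_num, abs_mul, Nat.abs_cast, mul_comm, pow_add]
    exact mul_le_mul (by exact_mod_cast hden) hq (abs_nonneg _) (by positivity)
  refine isFractionBoundedBy_iff.2
    ⟨?_, hden.trans (Nat.pow_le_pow_right two_pos (Nat.le_add_right a b))⟩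
  rw [← Int.cast_abs, Int.abs_eq_natAbs] at hnum
  exact_mod_cast hnum

end FitsBits

theorem den_add_dvd {q r : ℚ} {d : ℕ} (hq : q.den ∣ d) (hr : r.den ∣ d) : (q + r).den ∣ d :=
  (Rat.add_den_dvd_lcm q r).trans (Nat.lcm_dvd hq hr)

theorem den_mul_dvd {q r : ℚ} {d e : ℕ} (hq : q.den ∣ d) (hr : r.den ∣ e) :
    (q * r).den ∣ d * e :=
  (Rat.mul_den_dvd q r).trans (mul_dvd_mul hq hr)

theorem den_sum_dvd {ι : Type*} {f : ι → ℚ} {s : Finset ι} {d : ℕ}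
    (hf : ∀ i ∈ s, (f i).den ∣ d) : (∑ i ∈ s, f i).den ∣ d :=
  Finset.sum_induction f (fun q => q.den ∣ d) (fun _ _ => den_add_dvd) (by simp) hf

/-! ### Verification of programs with resource bounds -/

namespace RatRam

instance : Add Term := ⟨.bin .add⟩
instance : Sub Term := ⟨.bin .sub⟩
instance : Mul Term := ⟨.bin .mul⟩
instance : Div Term := ⟨.bin .div⟩

@[simp] theorem Term.cost_const (q : ℚ) : (Term.const q).cost = 0 := rfl
@[simp] theorem Term.cost_reg (r : ℕ) : (Term.reg r).cost = 0 := rfl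
@[simp] theorem Term.cost_cell (a : ℕ) (e : Term) : (Term.cell a e).cost = e.cost + 1 := rfl
@[simp] theorem Term.cost_floor (e : Term) : e.floor.cost = e.cost + 1 := rfl
@[simp] theorem Term.cost_add (e f : Term) : (e + f).cost = e.cost + f.cost + 1 := rfl
@[simp] theorem Term.cost_sub (e f : Term) : (e - f).cost = e.cost + f.cost + 1 := rfl
@[simp] theorem Term.cost_mul (e f : Term) : (e * f).cost = e.cost + f.cost + 1 := rfl
@[simp] theorem Term.cost_div (e f : Term) : (e / f).cost = e.cost + f.cost + 1 := rfl

/-- In memory `s` the expression `e` has the value `v`, and the results of all operations in its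
evaluation fit into `b` bits. -/
def Term.Computes (b : ℕ) (s : State) (e : Term) (v : ℚ) : Prop :=
  e.eval s = v ∧ ∀ q ∈ e.computed s, FitsBits b q

namespace Term.Computes

variable {b : ℕ} {s : State} {e f : Term} {v w : ℚ} {m n : ℕ}

theorem const {q : ℚ} : (Term.const q).Computes b s q :=
  ⟨rfl, by simp [Term.computed]⟩

theorem reg {r : ℕ} (h : s.reg r = v) : (Term.reg r).Computes b s v :=
  ⟨h, by simp [Term.computed]⟩

theorem cell {a : ℕ} (he : e.Computes b s n) (h : s.arr a n = v) :
    (Term.cell a e).Computes b s v :=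
  ⟨by rw [Term.eval, he.1, Nat.floor_natCast, h], he.2⟩

theorem bin {o : BinOp} (he : e.Computes b s v) (hf : f.Computes b s w)
    (h : FitsBits b (o.apply v w)) : (Term.bin o e f).Computes b s (o.apply v w) := by
  refine ⟨by rw [Term.eval, he.1, hf.1], fun q hq => ?_⟩
  simp only [Term.computed, List.mem_append, List.mem_singleton] at hq
  obtain (hq | hq) | rfl := hq
  exacts [he.2 q hq, hf.2 q hq, by rwa [he.1, hf.1]]

theorem add (he : e.Computes b s v) (hf : f.Computes b s w) (h : FitsBits b (v + w)) :
    (e + f).Computes b s (v + w) :=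
  he.bin hf h

theorem sub (he : e.Computes b s v) (hf : f.Computes b s w) (h : FitsBits b (v - w)) :
    (e - f).Computes b s (v - w) :=
  he.bin hf h

theorem mul (he : e.Computes b s v) (hf : f.Computes b s w) (h : FitsBits b (v * w)) :
    (e * f).Computes b s (v * w) :=
  he.bin hf h

theorem mul_self (he : e.Computes b s v) (h : FitsBits b (v ^ 2)) :
    (e * e).Computes b s (v ^ 2) := by
  rw [pow_two] at h ⊢
  exact he.mul he h

theorem div (he : e.Computes b s v) (hf : f.Computes b s w) (h : FitsBits b (v / w)) :
    (e / f).Computes b s (v / w) :=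
  he.bin hf h

theorem floor_of_nonneg (he : e.Computes b s v) (hv : 0 ≤ v) (h : ⌊v⌋₊ ≤ 2 ^ b) :
    e.floor.Computes b s (⌊v⌋₊ : ℕ) := by
  have hfloor : ((⌊v⌋₊ : ℕ) : ℚ) = ⌊v⌋ := natCast_floor_eq_intCast_floor hv
  refine ⟨by rw [Term.eval, he.1, hfloor], fun q hq => ?_⟩
  simp only [Term.computed, List.mem_append, List.mem_singleton] at hq
  obtain hq | rfl := hq
  exacts [he.2 q hq, by rw [he.1, ← hfloor]; exact .natCast h]

theorem add_natCast (he : e.Computes b s m) (hf : f.Computes b s n) (h : m + n ≤ 2 ^ b) :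
    (e + f).Computes b s ((m + n : ℕ) : ℚ) := by
  have hfit := FitsBits.natCast h
  rw [Nat.cast_add] at hfit ⊢
  exact he.add hf hfit

theorem mul_natCast (he : e.Computes b s m) (hf : f.Computes b s n) (h : m * n ≤ 2 ^ b) :
    (e * f).Computes b s ((m * n : ℕ) : ℚ) := by
  have hfit := FitsBits.natCast h
  rw [Nat.cast_mul] at hfit ⊢
  exact he.mul hf hfit

end Term.Computes

@[simp] theorem State.reg_setReg (s : State) (r r' : ℕ) (q : ℚ) :
    (s.setReg r q).reg r' = if r' = r then q else s.reg r' := by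
  simp [State.setReg, Function.update_apply]

@[simp] theorem State.arr_setReg (s : State) (r : ℕ) (q : ℚ) : (s.setReg r q).arr = s.arr :=
  rfl

@[simp] theorem State.reg_setCell (s : State) (a n : ℕ) (q : ℚ) :
    (s.setCell a n q).reg = s.reg :=
  rfl

@[simp] theorem State.arr_setCell (s : State) (a n a' : ℕ) (q : ℚ) :
    (s.setCell a n q).arr a' = if a' = a then Function.update (s.arr a) n q else s.arr a' := by
  simp only [State.setCell, Function.update_apply]

/-- The memories `s` and `s'` agree on all registers below `r` and all arrays below `a`. Registers
and arrays are allocated to nested parts of a program in increasing order, so this is the frame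
condition of every subprogram. -/
def State.AgreesBelow (r a : ℕ) (s s' : State) : Prop :=
  (∀ i < r, s'.reg i = s.reg i) ∧ ∀ j < a, s'.arr j = s.arr j

namespace State.AgreesBelow

variable {r r' a a' : ℕ} {s s' s'' : State}

theorem refl (s : State) : s.AgreesBelow r a s :=
  ⟨fun _ _ => rfl, fun _ _ => rfl⟩

theorem trans (h : s.AgreesBelow r a s') (h' : s'.AgreesBelow r a s'') :
    s.AgreesBelow r a s'' :=
  ⟨fun i hi => (h'.1 i hi).trans (h.1 i hi), fun j hj => (h'.2 j hj).trans (h.2 j hj)⟩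

theorem mono (h : s.AgreesBelow r a s') (hr : r' ≤ r) (ha : a' ≤ a) :
    s.AgreesBelow r' a' s' :=
  ⟨fun i hi => h.1 i (hi.trans_le hr), fun j hj => h.2 j (hj.trans_le ha)⟩

theorem setReg (h : s.AgreesBelow r a s') {i : ℕ} (hi : r ≤ i) (q : ℚ) :
    s.AgreesBelow r a (s'.setReg i q) :=
  ⟨fun l hl => by rw [reg_setReg, if_neg (by omega), h.1 l hl], h.2⟩

theorem setCell (h : s.AgreesBelow r a s') {i : ℕ} (hi : a ≤ i) (n : ℕ) (q : ℚ) :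
    s.AgreesBelow r a (s'.setCell i n q) :=
  ⟨h.1, fun l hl => by rw [arr_setCell, if_neg (by omega), h.2 l hl]⟩

end State.AgreesBelow

/-- `r := max (r, e)`. -/
def Program.assignMax (r : ℕ) (e : Term) : Program :=
  .branch (.reg r) e (.assign r e) .skip

/-- Total correctness with resource bounds: started in `s`, the program `c` halts after at most `n`
operations in a memory satisfying `Post`, and all numbers that it computes fit into `b` bits. -/
def Achieves (b : ℕ) (c : Program) (s : State) (n : ℕ) (Post : State → Prop) : Prop :=
  ∃ m ≤ n, ∃ T s', Run c s m T s' ∧ (∀ q ∈ T, FitsBits b q) ∧ Post s'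

namespace Achieves

variable {b n n' : ℕ} {c d : Program} {s : State} {e f : Term} {v w : ℚ} {r : ℕ}
  {Post Mid : State → Prop}

theorem mono (h : Achieves b c s n Mid) (hn : n ≤ n') (hP : ∀ s', Mid s' → Post s') :
    Achieves b c s n' Post := by
  obtain ⟨m, hm, T, s', hr, hT, hs⟩ := h
  exact ⟨m, hm.trans hn, T, s', hr, hT, hP _ hs⟩

theorem skip (h : Post s) : Achieves b .skip s 0 Post :=
  ⟨0, le_rfl, [], s, .skip s, by simp, h⟩

theorem assign (he : e.Computes b s v) (hv : FitsBits b v) (h : Post (s.setReg r v)) :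
    Achieves b (.assign r e) s (e.cost + 1) Post := by
  obtain ⟨rfl, he⟩ := he
  exact ⟨_, le_rfl, _, _, .assign r e s, by simpa [or_imp, forall_and] using ⟨he, hv⟩, h⟩

theorem store {a i : ℕ} (he : e.Computes b s i) (hf : f.Computes b s v) (hv : FitsBits b v)
    (h : Post (s.setCell a i v)) : Achieves b (.store a e f) s (e.cost + f.cost + 1) Post := by
  obtain ⟨he', he⟩ := he
  obtain ⟨rfl, hf⟩ := hf
  refine ⟨_, le_rfl, _, _, .store a e f s, ?_, by rwa [he', Nat.floor_natCast]⟩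
  simpa [or_imp, forall_and] using ⟨he, hf, hv⟩

theorem seq (hc : Achieves b c s n Mid) (hd : ∀ s', Mid s' → Achieves b d s' n' Post) :
    Achieves b (.seq c d) s (n + n') Post := by
  obtain ⟨m, hm, T, s', hr, hT, hs⟩ := hc
  obtain ⟨m', hm', T', s'', hr', hT', hs'⟩ := hd s' hs
  exact ⟨m + m', by omega, T ++ T', s'', hr.seq hr',
    by simpa [or_imp, forall_and] using ⟨hT, hT'⟩, hs'⟩

theorem assign_seq (he : e.Computes b s v) (hv : FitsBits b v)
    (hd : Achieves b d (s.setReg r v) n Post) :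
    Achieves b (.seq (.assign r e) d) s (e.cost + 1 + n) Post :=
  (assign (Post := (· = s.setReg r v)) he hv rfl).seq (by rintro _ rfl; exact hd)

theorem branch (he : e.Computes b s v) (hf : f.Computes b s w)
    (hc : v < w → Achieves b c s n Post) (hd : ¬ v < w → Achieves b d s n Post) :
    Achieves b (.branch e f c d) s (e.cost + f.cost + 1 + n) Post := by
  obtain ⟨rfl, he⟩ := he
  obtain ⟨rfl, hf⟩ := hf
  by_cases h : e.eval s < f.eval s
  · obtain ⟨m, hm, T, s', hr, hT, hs⟩ := hc h
    exact ⟨_, Nat.add_le_add_left hm _, _, s', .branch_true h hr,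
      by simpa [or_imp, forall_and] using ⟨he, hf, hT⟩, hs⟩
  · obtain ⟨m, hm, T, s', hr, hT, hs⟩ := hd h
    exact ⟨_, Nat.add_le_add_left hm _, _, s', .branch_false h hr,
      by simpa [or_imp, forall_and] using ⟨he, hf, hT⟩, hs⟩

theorem assignMax (hv : s.reg r = v) (he : e.Computes b s w) (hw : FitsBits b w)
    (h : Post (s.setReg r (max w v))) :
    Achieves b (.assignMax r e) s (2 * e.cost + 2) Post := by
  have hskip : s.setReg r v = s := by rw [← hv, State.setReg, Function.update_eq_self]
  refine (branch (.reg hv) he (fun hlt => assign he hw ?_) fun hlt => (skip ?_).mono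
    (Nat.zero_le _) fun _ => id).mono (by rw [Term.cost_reg]; omega) fun _ => id
  · rwa [max_eq_left hlt.le] at h
  · rwa [max_eq_right (not_lt.1 hlt), hskip] at h

theorem loop {i k J : ℕ} (I : ℕ → State → Prop) (h0 : I 0 s)
    (hlt : ∀ j < J, ∀ s, I j s → s.reg i < s.reg k) (hend : ∀ s, I J s → ¬ s.reg i < s.reg k)
    (hbody : ∀ j < J, ∀ s, I j s → Achieves b c s n (I (j + 1))) :
    Achieves b (.loop (.reg i) (.reg k) c) s (J * (n + 1) + 1) (I J) := by
  suffices H : ∀ m j s, j + m = J → I j s →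
      Achieves b (.loop (.reg i) (.reg k) c) s (m * (n + 1) + 1) (I J) from
    H J 0 s (by omega) h0
  intro m
  induction m with
  | zero =>
    rintro j s rfl hj
    exact ⟨1, by omega, [], s, .loop_false (hend s hj), by simp, hj⟩
  | succ m ih =>
    intro j s hjm hj
    obtain ⟨m₁, hm₁, T₁, s₁, hr₁, hT₁, hI₁⟩ := hbody j (by omega) s hj
    obtain ⟨m₂, hm₂, T₂, s₂, hr₂, hT₂, hI₂⟩ := ih (j + 1) s₁ (by omega) hI₁
    refine ⟨_, ?_, _, s₂, .loop_true (hlt j (by omega) s hj) hr₁ hr₂, ?_, hI₂⟩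
    · rw [Term.cost_reg, Term.cost_reg, Nat.succ_mul]
      omega
    · simpa [Term.computed, or_imp, forall_and] using ⟨hT₁, hT₂⟩

end Achieves

/-- `for r i := 0, 1, …, r k - 1 do c`. -/
def forLoop (i k : ℕ) (c : Program) : Program :=
  .seq (.assign i (.const 0))
    (.loop (.reg i) (.reg k) (.seq c (.assign i (.reg i + .const 1))))

theorem Achieves.forLoop {b n : ℕ} {c : Program} {s : State} {i k a J : ℕ}
    (I : ℕ → State → Prop) (hki : k < i) (hk : s.reg k = J) (hJ : J ≤ 2 ^ b)
    (hI : ∀ j s' q, I j s' → I j (s'.setReg i q)) (h0 : I 0 s)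
    (hbody : ∀ j < J, ∀ s', s.AgreesBelow i a s' → s'.reg i = j → I j s' →
      Achieves b c s' n fun s'' => s'.AgreesBelow (i + 1) a s'' ∧ I (j + 1) s'') :
    Achieves b (forLoop i k c) s (J * (n + 3) + 2) fun s' => s.AgreesBelow i a s' ∧ I J s' := by
  have hloop := Achieves.loop (b := b) (s := s.setReg i 0) (i := i) (k := k) (J := J)
    (c := .seq c (.assign i (.reg i + .const 1))) (n := n + 2)
    (fun j s' => s.AgreesBelow i a s' ∧ s'.reg i = j ∧ I j s')
    ⟨(State.AgreesBelow.refl s).setReg le_rfl 0, by simp, hI _ _ _ h0⟩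
    (fun j hj s' hs' => ?_) (fun s' hs' => ?_) ?_
  · refine (Achieves.assign_seq .const .zero hloop).mono ?_ fun s' hs' => ⟨hs'.1, hs'.2.2⟩
    rw [Term.cost_const]
    linarith
  · rw [hs'.2.1, (hs'.1.1 k hki).trans hk]
    exact_mod_cast hj
  · rw [hs'.2.1, (hs'.1.1 k hki).trans hk]
    exact lt_irrefl _
  · rintro j hj s' ⟨hs', hi, hIj⟩
    refine (hbody j hj s' hs' hi hIj).seq (n' := 2) ?_
    rintro s'' ⟨hs'', hIj'⟩
    have hij : s''.reg i = j := (hs''.1 i i.lt_succ_self).trans hi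
    have hjb : j + 1 ≤ 2 ^ b := (Nat.succ_le_of_lt hj).trans hJ
    refine .assign (Term.Computes.add_natCast (.reg hij) (by simpa using .const) hjb)
      (.natCast hjb) ?_
    exact ⟨(hs'.trans (hs''.mono i.le_succ le_rfl)).setReg le_rfl _, by simp, hI _ _ _ hIj'⟩

end RatRam

/-! ### The quantities computed by the algorithm -/

/-- The (reversed) convolution `∑ a < n, f a * g (j + a)`. Its value at `j` depends on `g` only from
`j` on, which allows the algorithm to overwrite `g` in place, in increasing order of `j`. -/
def correlate (n : ℕ) (f g : ℕ → ℚ) (j : ℕ) : ℚ :=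
  ∑ a ∈ Finset.range n, f a * g (j + a)

theorem correlate_mem_Icc {n : ℕ} {f g : ℕ → ℚ} (hf : ∀ a, 0 ≤ f a)
    (hsum : ∑ a ∈ Finset.range n, f a ≤ 1) (hg : ∀ j, g j ∈ Set.Icc 0 1) (j : ℕ) :
    correlate n f g j ∈ Set.Icc 0 1 :=
  ⟨Finset.sum_nonneg fun a _ => mul_nonneg (hf a) (hg _).1,
    (Finset.sum_le_sum fun a _ => mul_le_of_le_one_right (hf a) (hg _).2).trans hsum⟩

theorem den_correlate_dvd {d e : ℕ} {f g : ℕ → ℚ} (hf : ∀ a, (f a).den ∣ d)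
    (hg : ∀ j, (g j).den ∣ e) (n j : ℕ) : (correlate n f g j).den ∣ d * e :=
  den_sum_dvd fun a _ => den_mul_dvd (hf a) (hg _)

/-- An instance of the transport problem in the form in which it is stored in memory: the atom `l`
of the `k`-th marginal has index `k * L + l`, and `y 0`, `y 1` are the two atoms `y₁`, `y₂` of
`ν_t`. -/
structure FlatInstance where
  (K L : ℕ)
  (p x : ℕ → ℚ)
  (y : Fin 2 → ℕ → ℚ)
  (t ε : ℚ)

namespace FlatInstance

/-- The data satisfy the assumptions of the theorem, `U` being the bound on numerators and
denominators. -/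
structure IsValid (D : FlatInstance) (U : ℕ) : Prop where
  K_pos : 0 < D.K
  L_pos : 0 < D.L
  p_nonneg : ∀ n, 0 ≤ D.p n
  p_sum : ∀ k < D.K, ∑ l ∈ Finset.range D.L, D.p (k * D.L + l) = 1
  t_nonneg : 0 ≤ D.t
  t_le_one : D.t ≤ 1
  p_bounded : ∀ n, IsFractionBoundedBy U (D.p n)
  x_bounded : ∀ n, IsFractionBoundedBy U (D.x n)
  y_bounded : ∀ j n, IsFractionBoundedBy U (D.y j n)
  t_bounded : IsFractionBoundedBy U D.t

theorem IsValid.mono {D : FlatInstance} {U V : ℕ} (hD : D.IsValid U) (hUV : U ≤ V) :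
    D.IsValid V :=
  { hD with
    p_bounded := fun n => (hD.p_bounded n).mono hUV
    x_bounded := fun n => (hD.x_bounded n).mono hUV
    y_bounded := fun j n => (hD.y_bounded j n).mono hUV
    t_bounded := hD.t_bounded.mono hUV }

variable (D : FlatInstance)

/-- The signed distance from the atom with index `n` to `y j` in the coordinate `n / L` of its
marginal. -/
def dev (j : Fin 2) (n : ℕ) : ℚ :=
  D.x n - D.y j (n / D.L)

/-- The sum of the squared distances of an atom to both targets; an upper bound for `|gap n|` whose
maximum is easier to compute. -/
def sqSum (n : ℕ) : ℚ :=
  D.dev 0 n ^ 2 + D.dev 1 n ^ 2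

/-- The contribution of an atom of a marginal to the cost gap `‖x - y₁‖ ^ 2 - ‖x - y₂‖ ^ 2`. -/
def gap (n : ℕ) : ℚ :=
  D.dev 0 n ^ 2 - D.dev 1 n ^ 2

/-- The contribution of the first `n` atoms to the expectation of `‖x - y₂‖ ^ 2`. -/
def meanCost (n : ℕ) : ℚ :=
  ∑ i ∈ Finset.range n, D.p i * D.dev 1 i ^ 2

/-- The running maximum of `0` and `sqSum` over the first `n` atoms. -/
def maxSqSum (n : ℕ) : ℚ :=
  (Finset.range n).fold max 0 D.sqSum

/-- All gaps lie in the interval `[-scale, scale]`. -/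
def scale : ℚ :=
  D.maxSqSum (D.K * D.L)

/-- The index of the grid point to which `gap n` is rounded down, for the grid of `2 * N + 1`
equidistant points in `[-scale, scale]`. -/
def grid (N n : ℕ) : ℕ :=
  ⌊D.gap n * N / D.scale + N⌋₊

/-- The mass that the first `m` atoms of the `k`-th marginal give to the grid point `a`. -/
def binMass (N k m a : ℕ) : ℚ :=
  ∑ l ∈ Finset.range m, if D.grid N (k * D.L + l) = a then D.p (k * D.L + l) else 0

/-- The probability that the grid indices of the first `k` marginals sum up to `2 * N * K - j`; the
index is reversed for the sake of `correlate`. -/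
def sumMass (N : ℕ) : ℕ → ℕ → ℚ
  | 0 => fun j => if j = 2 * N * D.K then 1 else 0
  | k + 1 => correlate (2 * N + 1) (D.binMass N k D.L) (sumMass N k)

/-- The probability that the grid indices of all marginals sum up to less than `j`. -/
def cumMass (N j : ℕ) : ℚ :=
  ∑ s ∈ Finset.range j, D.sumMass N D.K (2 * N * D.K - s)

/-- The layer-cake sum `∑ s < j, min t (P (S ≤ s))` for the sum `S` of all grid indices. -/
def truncSum (N j : ℕ) : ℚ :=
  ∑ s ∈ Finset.range j, min D.t (D.cumMass N (s + 1))

/-- The output of the algorithm at resolution `N`: the transport cost when the gaps are replaced by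
their grid points. -/
def approxValue (N : ℕ) : ℚ :=
  D.meanCost (D.K * D.L) + D.scale / N * (D.K * N * D.t - D.truncSum N (2 * N * D.K))

variable {D}

theorem index_lt {k l : ℕ} (hk : k < D.K) (hl : l < D.L) : k * D.L + l < D.K * D.L :=
  calc k * D.L + l < (k + 1) * D.L := by rw [Nat.succ_mul]; omega
    _ ≤ D.K * D.L := Nat.mul_le_mul_right _ hk

theorem index_div {l : ℕ} (hl : l < D.L) (k : ℕ) : (k * D.L + l) / D.L = k := by
  rw [mul_comm, Nat.mul_add_div (by omega), Nat.div_eq_of_lt hl, add_zero]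

theorem dev_sq_le_sqSum (j : Fin 2) (n : ℕ) : D.dev j n ^ 2 ≤ D.sqSum n := by
  fin_cases j
  exacts [le_add_of_nonneg_right (sq_nonneg _), le_add_of_nonneg_left (sq_nonneg _)]

theorem abs_gap_le_sqSum (n : ℕ) : |D.gap n| ≤ D.sqSum n := by
  have h0 := sq_nonneg (D.dev 0 n)
  have h1 := sq_nonneg (D.dev 1 n)
  rw [abs_le, gap, sqSum]
  constructor <;> linarith

theorem maxSqSum_succ (n : ℕ) : D.maxSqSum (n + 1) = max (D.sqSum n) (D.maxSqSum n) := by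
  rw [maxSqSum, Finset.range_add_one, Finset.fold_insert Finset.notMem_range_self, maxSqSum]

theorem maxSqSum_nonneg (n : ℕ) : 0 ≤ D.maxSqSum n :=
  (Finset.le_fold_max 0).2 (.inl le_rfl)

theorem scale_nonneg : 0 ≤ D.scale :=
  maxSqSum_nonneg _

theorem sqSum_le_scale {n : ℕ} (hn : n < D.K * D.L) : D.sqSum n ≤ D.scale :=
  (Finset.le_fold_max _).2 (.inr ⟨n, Finset.mem_range.2 hn, le_rfl⟩)

theorem abs_gap_le_scale {n : ℕ} (hn : n < D.K * D.L) : |D.gap n| ≤ D.scale :=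
  (abs_gap_le_sqSum n).trans (sqSum_le_scale hn)

theorem maxSqSum_induction {P : ℚ → Prop} (h0 : P 0) (h : ∀ n, P (D.sqSum n)) (n : ℕ) :
    P (D.maxSqSum n) := by
  induction n with
  | zero => exact h0
  | succ n ih =>
    rw [maxSqSum_succ]
    rcases max_choice (D.sqSum n) (D.maxSqSum n) with hn | hn <;> rw [hn]
    exacts [h n, ih]

theorem gap_mul_div_add_mem_Icc (N : ℕ) {n : ℕ} (hn : n < D.K * D.L) :
    D.gap n * N / D.scale + N ∈ Set.Icc (0 : ℚ) (2 * N) := by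
  have hratio : |D.gap n / D.scale| ≤ 1 := by
    rw [abs_div, abs_of_nonneg scale_nonneg]
    exact div_le_one_of_le₀ (abs_gap_le_scale hn) scale_nonneg
  obtain ⟨hlower, hupper⟩ := abs_le.1 hratio
  rw [mul_div_right_comm]
  constructor <;> nlinarith [N.cast_nonneg (α := ℚ)]

theorem grid_le (N : ℕ) {n : ℕ} (hn : n < D.K * D.L) : D.grid N n ≤ 2 * N := by
  refine Nat.floor_le_of_le ?_
  exact_mod_cast (gap_mul_div_add_mem_Icc N hn).2

theorem sumMass_eq_zero (N k : ℕ) {j : ℕ} (hj : 2 * N * D.K < j) : D.sumMass N k j = 0 := by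
  induction k generalizing j with
  | zero => exact if_neg hj.ne'
  | succ k ih =>
    rw [sumMass, correlate]
    exact Finset.sum_eq_zero fun a _ => by rw [ih (by omega), mul_zero]

variable (D) in
/-- A common denominator of the probabilities of the first `k` marginals. -/
def commonDen (k : ℕ) : ℕ :=
  ∏ n ∈ Finset.range (k * D.L), (D.p n).den

theorem commonDen_pos (k : ℕ) : 0 < D.commonDen k :=
  Finset.prod_pos fun n _ => (D.p n).den_pos

theorem commonDen_succ (k : ℕ) :
    D.commonDen (k + 1) =
      (∏ l ∈ Finset.range D.L, (D.p (k * D.L + l)).den) * D.commonDen k := by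
  rw [commonDen, Nat.succ_mul, Finset.prod_range_add, mul_comm, commonDen]

theorem den_binMass_dvd (N k a : ℕ) :
    (D.binMass N k D.L a).den ∣ ∏ l ∈ Finset.range D.L, (D.p (k * D.L + l)).den := by
  refine den_sum_dvd fun l hl => ?_
  split_ifs
  exacts [Finset.dvd_prod_of_mem (fun l => (D.p (k * D.L + l)).den) hl, one_dvd _]

theorem den_correlate_binMass_dvd {N k : ℕ} (hk : ∀ j, (D.sumMass N k j).den ∣ D.commonDen k)
    (n j : ℕ) :
    (correlate n (D.binMass N k D.L) (D.sumMass N k) j).den ∣ D.commonDen (k + 1) := by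
  rw [commonDen_succ]
  exact den_correlate_dvd (den_binMass_dvd N k) hk n j

theorem den_sumMass_dvd (N k j : ℕ) : (D.sumMass N k j).den ∣ D.commonDen k := by
  induction k generalizing j with
  | zero =>
    simp only [sumMass]
    split_ifs <;> exact one_dvd _
  | succ k ih => exact den_correlate_binMass_dvd ih _ j

theorem den_cumMass_dvd (N j : ℕ) : (D.cumMass N j).den ∣ D.commonDen D.K :=
  den_sum_dvd fun _ _ => den_sumMass_dvd N D.K _

theorem den_truncSum_dvd (N j : ℕ) : (D.truncSum N j).den ∣ D.t.den * D.commonDen D.K := by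
  refine den_sum_dvd fun s _ => ?_
  rcases min_choice D.t (D.cumMass N (s + 1)) with h | h <;> rw [h]
  exacts [dvd_mul_right _ _, (den_cumMass_dvd N _).mul_left _]

namespace IsValid

section Mass

variable {U : ℕ} (hD : D.IsValid U)
include hD

theorem binMass_nonneg (N k m a : ℕ) : 0 ≤ D.binMass N k m a := by
  refine Finset.sum_nonneg fun l _ => ?_
  split_ifs
  exacts [hD.p_nonneg _, le_rfl]

theorem sum_binMass_le_one (N : ℕ) {k : ℕ} (hk : k < D.K) (n : ℕ) :
    ∑ a ∈ Finset.range n, D.binMass N k D.L a ≤ 1 := by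
  simp only [binMass]
  rw [Finset.sum_comm, ← hD.p_sum k hk]
  refine Finset.sum_le_sum fun l _ => ?_
  rw [Finset.sum_ite_eq]
  split_ifs
  exacts [le_rfl, hD.p_nonneg _]

theorem correlate_binMass_mem_Icc {N k : ℕ} (hk : k < D.K)
    (hsum : ∀ j, D.sumMass N k j ∈ Set.Icc 0 1) (n j : ℕ) :
    correlate n (D.binMass N k D.L) (D.sumMass N k) j ∈ Set.Icc 0 1 :=
  correlate_mem_Icc (hD.binMass_nonneg N k D.L) (hD.sum_binMass_le_one N hk n) hsum j

theorem sumMass_mem_Icc (N : ℕ) {k : ℕ} (hk : k ≤ D.K) (j : ℕ) :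
    D.sumMass N k j ∈ Set.Icc 0 1 := by
  induction k generalizing j with
  | zero =>
    simp only [sumMass]
    split_ifs <;> simp
  | succ k ih => exact hD.correlate_binMass_mem_Icc hk (fun j => ih (by omega) j) _ j

theorem cumMass_mem_Icc (N j : ℕ) : D.cumMass N j ∈ Set.Icc (0 : ℚ) j := by
  refine ⟨Finset.sum_nonneg fun _ _ => (hD.sumMass_mem_Icc N le_rfl _).1, ?_⟩
  simpa [cumMass] using Finset.sum_le_card_nsmul (Finset.range j) _ 1
    fun s _ => (hD.sumMass_mem_Icc N le_rfl (2 * N * D.K - s)).2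

theorem truncSum_mem_Icc (N j : ℕ) : D.truncSum N j ∈ Set.Icc (0 : ℚ) j := by
  refine ⟨Finset.sum_nonneg fun _ _ => le_min hD.t_nonneg (hD.cumMass_mem_Icc N _).1, ?_⟩
  simpa [truncSum] using Finset.sum_le_card_nsmul (Finset.range j) _ 1
    fun s _ => (min_le_left D.t (D.cumMass N (s + 1))).trans hD.t_le_one

theorem scale_le : D.scale ≤ 8 * (U : ℚ) ^ 2 := by
  have hdev (j : Fin 2) (n : ℕ) : D.dev j n ^ 2 ≤ (2 * U : ℚ) ^ 2 := by
    rw [sq_le_sq, abs_of_nonneg (by positivity : (0 : ℚ) ≤ 2 * U), two_mul]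
    exact (abs_sub _ _).trans (add_le_add (hD.x_bounded n).abs_le (hD.y_bounded j _).abs_le)
  refine maxSqSum_induction (P := (· ≤ 8 * (U : ℚ) ^ 2)) (by positivity) (fun n => ?_) _
  rw [sqSum]
  linarith [hdev 0 n, hdev 1 n]

end Mass

section Fits

variable {u N β : ℕ} (hD : D.IsValid (2 ^ u)) (hβ : D.K * D.L * (u + 1) ≤ β) (hN : N ≤ 2 ^ β)

include hD in
theorem fitsBits_dev (j : Fin 2) (n : ℕ) : FitsBits (u + u + 1) (D.dev j n) :=
  FitsBits.sub (hD.x_bounded n) (hD.y_bounded j _)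

include hD in
theorem fitsBits_dev_sq (j : Fin 2) (n : ℕ) : FitsBits (4 * u + 2) (D.dev j n ^ 2) := by
  rw [pow_two]
  exact ((hD.fitsBits_dev j n).mul (hD.fitsBits_dev j n)).mono (by omega)

include hD in
theorem fitsBits_gap (n : ℕ) : FitsBits (8 * u + 5) (D.gap n) :=
  ((hD.fitsBits_dev_sq 0 n).sub (hD.fitsBits_dev_sq 1 n)).mono (by omega)

include hD in
theorem fitsBits_sqSum (n : ℕ) : FitsBits (8 * u + 5) (D.sqSum n) :=
  ((hD.fitsBits_dev_sq 0 n).add (hD.fitsBits_dev_sq 1 n)).mono (by omega)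

include hD in
theorem fitsBits_maxSqSum (n : ℕ) : FitsBits (8 * u + 5) (D.maxSqSum n) :=
  maxSqSum_induction .zero hD.fitsBits_sqSum n

include hD hβ in
theorem le_of_size_le : D.K ≤ β ∧ D.L ≤ β ∧ u + 1 ≤ β := by
  have hK := hD.K_pos
  have hL := hD.L_pos
  refine ⟨?_, ?_, ?_⟩ <;> refine le_trans ?_ hβ
  · exact (Nat.le_mul_of_pos_right _ hL).trans (Nat.le_mul_of_pos_right _ u.succ_pos)
  · exact (Nat.le_mul_of_pos_left _ hK).trans (Nat.le_mul_of_pos_right _ u.succ_pos)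
  · exact Nat.le_mul_of_pos_left _ (Nat.mul_pos hK hL)

include hD hβ in
theorem fitsBits_meanCost {n : ℕ} (hn : n ≤ D.K * D.L) : FitsBits (5 * β) (D.meanCost n) := by
  refine (FitsBits.sum fun i _ => FitsBits.mul (hD.p_bounded i) (hD.fitsBits_dev_sq 1 i)).mono ?_
  calc (Finset.range n).card * (u + (4 * u + 2) + 1) ≤ D.K * D.L * (5 * (u + 1)) := by
        rw [Finset.card_range]
        exact Nat.mul_le_mul hn (by omega)
    _ = 5 * (D.K * D.L * (u + 1)) := by ring
    _ ≤ 5 * β := Nat.mul_le_mul_left _ hβ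

include hD hβ in
theorem fitsBits_binMass (N k a : ℕ) {m : ℕ} (hm : m ≤ D.L) :
    FitsBits β (D.binMass N k m a) := by
  have hterm (l : ℕ) :
      FitsBits u (if D.grid N (k * D.L + l) = a then D.p (k * D.L + l) else 0) := by
    split_ifs
    exacts [hD.p_bounded _, .zero]
  refine (FitsBits.sum fun l _ => hterm l).mono (le_trans ?_ hβ)
  rw [Finset.card_range]
  exact Nat.mul_le_mul_right _ (hm.trans (Nat.le_mul_of_pos_left _ hD.K_pos))

include hD hβ in
theorem commonDen_le {k : ℕ} (hk : k ≤ D.K) : D.commonDen k ≤ 2 ^ β := by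
  calc D.commonDen k ≤ ∏ _n ∈ Finset.range (k * D.L), 2 ^ u :=
        Finset.prod_le_prod' fun n _ => (isFractionBoundedBy_iff.1 (hD.p_bounded n)).2
    _ = 2 ^ (k * D.L * u) := by rw [Finset.prod_const, Finset.card_range, ← pow_mul, mul_comm]
    _ ≤ 2 ^ β := Nat.pow_le_pow_right two_pos
        ((Nat.mul_le_mul (Nat.mul_le_mul_right _ hk) u.le_succ).trans hβ)

include hD hβ in
theorem fitsBits_sumMass {k : ℕ} (hk : k ≤ D.K) (N j : ℕ) : FitsBits β (D.sumMass N k j) := by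
  obtain ⟨hnonneg, hle⟩ := hD.sumMass_mem_Icc N hk j
  exact FitsBits.of_den_dvd (b := 0) (commonDen_pos _) (hD.commonDen_le hβ hk)
    (den_sumMass_dvd N k j) (by simpa [abs_of_nonneg hnonneg])

include hD hβ in
theorem fitsBits_correlate {k : ℕ} (hk : k < D.K) (N n j : ℕ) :
    FitsBits β (correlate n (D.binMass N k D.L) (D.sumMass N k) j) := by
  obtain ⟨hnonneg, hle⟩ := hD.correlate_binMass_mem_Icc hk (hD.sumMass_mem_Icc N hk.le) n j
  exact FitsBits.of_den_dvd (b := 0) (commonDen_pos _) (hD.commonDen_le hβ hk)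
    (den_correlate_binMass_dvd (den_sumMass_dvd N k) n j) (by simpa [abs_of_nonneg hnonneg])

include hD hβ hN in
theorem two_mul_mul_lt_two_pow : 2 * N * D.K + 1 < 2 ^ (4 * β) := by
  obtain ⟨hK, -, hβ1⟩ := hD.le_of_size_le hβ
  have hKβ : D.K < 2 ^ β := hK.trans_lt β.lt_two_pow_self
  calc 2 * N * D.K + 1 < 2 * (2 ^ β * 2 ^ β) + 2 * (2 ^ β * 2 ^ β) := by
        have := Nat.mul_le_mul hN hKβ.le
        have : 1 ≤ 2 ^ β * 2 ^ β := Nat.mul_pos β.two_pow_pos β.two_pow_pos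
        rw [mul_assoc]
        omega
    _ = 2 ^ (2 * β + 2) := by ring
    _ ≤ 2 ^ (4 * β) := Nat.pow_le_pow_right two_pos (by omega)

include hD hβ hN in
theorem fitsBits_cumMass {j : ℕ} (hj : j ≤ 2 * N * D.K) : FitsBits (5 * β) (D.cumMass N j) := by
  obtain ⟨hnonneg, hle⟩ := hD.cumMass_mem_Icc N j
  have htop := hD.two_mul_mul_lt_two_pow hβ hN
  refine (FitsBits.of_den_dvd (b := 4 * β) (commonDen_pos _) (hD.commonDen_le hβ le_rfl)
    (den_cumMass_dvd N j) ?_).mono (by omega)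
  rw [abs_of_nonneg hnonneg]
  exact hle.trans (by exact_mod_cast hj.trans (by omega))

include hD hβ hN in
theorem fitsBits_truncSum {j : ℕ} (hj : j ≤ 2 * N * D.K) :
    FitsBits (6 * β) (D.truncSum N j) := by
  obtain ⟨hnonneg, hle⟩ := hD.truncSum_mem_Icc N j
  have htop := hD.two_mul_mul_lt_two_pow hβ hN
  have hden : D.t.den * D.commonDen D.K ≤ 2 ^ (2 * β) := by
    rw [two_mul, pow_add]
    exact Nat.mul_le_mul ((isFractionBoundedBy_iff.1 hD.t_bounded).2.trans
      (Nat.pow_le_pow_right two_pos (by have := hD.le_of_size_le hβ; omega)))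
      (hD.commonDen_le hβ le_rfl)
  refine (FitsBits.of_den_dvd (b := 4 * β) (Nat.mul_pos D.t.den_pos (commonDen_pos _)) hden
    (den_truncSum_dvd N j) ?_).mono (by omega)
  rw [abs_of_nonneg hnonneg]
  exact hle.trans (by exact_mod_cast hj.trans (by omega))

end Fits

end IsValid

end FlatInstance

/-! ### The algorithm -/

namespace RatRam

/-- The squared distance to `y_j` in one coordinate, for expressions that evaluate to the index of
an atom and the index of its marginal. -/
def sqDev (j : Fin 2) (atom marginal : Term) : Term :=
  (.cell 1 atom - .cell (2 + j) marginal) * (.cell 1 atom - .cell (2 + j) marginal)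

/-- The index of the marginal of the atom in register `6`. -/
def scanMarginal : Term :=
  .floor (.reg 6 / .reg 1)

/-- Updates the running maximum of `sqSum` in register `7` and the expected squared distance to `y₂`
in register `8` by the atom in register `6`. -/
def scanStep : Program :=
  .seq (.assignMax 7 (sqDev 0 (.reg 6) scanMarginal + sqDev 1 (.reg 6) scanMarginal))
    (.assign 8 (.reg 8 + .cell 0 (.reg 6) * sqDev 1 (.reg 6) scanMarginal))

/-- One pass over the atoms, which computes `scale` and `meanCost`. -/
def scanProgram : Program :=
  .seq (.assign 5 (.reg 0 * .reg 1)) <|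
  .seq (.assign 7 (.const 0)) <|
  .seq (.assign 8 (.const 0)) <|
  forLoop 6 5 scanStep

/-- Doubles the resolution in register `10` until the error bound in register `9` is at most `ε`. -/
def refineProgram : Program :=
  .seq (.assign 10 (.const 1)) <|
  .loop (.reg 3) (.reg 9) <|
    .seq (.assign 10 (.reg 10 * .const 2)) (.assign 9 (.reg 9 / .const 2))

/-- Computes the loop bounds and the distribution of the empty sum. -/
def setupProgram : Program :=
  .seq (.assign 11 (.const 2 * .reg 10 * .reg 0)) <|
  .seq (.assign 12 (.const 2 * .reg 10 + .const 1)) <|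
  .seq (.assign 13 (.reg 11 + .const 1)) <|
  .store 4 (.reg 11) (.const 1)

/-- Empties the bins. -/
def clearProgram : Program :=
  forLoop 15 12 (.store 5 (.reg 15) (.const 0))

/-- The index of the current atom of the current marginal. -/
def binAtom : Term :=
  .reg 14 * .reg 1 + .reg 15

/-- The grid index of the current atom. -/
def binIndex : Term :=
  .floor ((sqDev 0 binAtom (.reg 14) - sqDev 1 binAtom (.reg 14)) * .reg 10 / .reg 7 + .reg 10)

/-- Distributes the masses of the current marginal to the bins. -/
def binProgram : Program :=
  forLoop 15 1 (.store 5 binIndex (.cell 5 binIndex + .cell 0 binAtom))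

/-- Computes one value of the convolution of array `4` with array `5`. -/
def dotProgram : Program :=
  .seq (.assign 17 (.const 0)) <|
  forLoop 16 12 (.assign 17 (.reg 17 + .cell 5 (.reg 16) * .cell 4 (.reg 15 + .reg 16)))

/-- Replaces array `4` by its convolution with array `5`. -/
def convolveProgram : Program :=
  forLoop 15 13 (.seq dotProgram (.store 4 (.reg 15) (.reg 17)))

/-- Computes the distribution of the sum of the grid indices of all marginals. -/
def sumProgram : Program :=
  forLoop 14 0 (.seq clearProgram (.seq binProgram convolveProgram))

/-- Adds the next probability to the cumulative mass in register `15`, and the truncation of the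
latter at `t` to register `16`. -/
def evalStep : Program :=
  .seq (.assign 15 (.reg 15 + .cell 4 (.reg 11 - .reg 14))) <|
  .branch (.reg 2) (.reg 15) (.assign 16 (.reg 16 + .reg 2)) (.assign 16 (.reg 16 + .reg 15))

/-- Computes `approxValue` from the distribution of the sum of the grid indices. -/
def evalProgram : Program :=
  .seq (.assign 15 (.const 0)) <|
  .seq (.assign 16 (.const 0)) <|
  .seq (forLoop 14 11 evalStep) <|
  .assign 4 (.reg 8 + .reg 7 / .reg 10 * (.reg 0 * .reg 10 * .reg 2 - .reg 16))

/-- Computes `approxValue` at the coarsest resolution `2 ^ m` whose error bound is at most `ε`. -/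
def approximationProgram : Program :=
  .seq refineProgram (.seq setupProgram (.seq sumProgram evalProgram))

/-- The algorithm of the theorem. The registers hold
* `0`–`3`: the input `K`, `L`, `t`, `ε`;  `4`: the output;
* `5`: `K * L`;  `6`: counter of the scan;  `7`: `scale`;  `8`: `meanCost`;
* `9`: the error bound `K * scale / N`;  `10`: the resolution `N`;
* `11`: `2 * N * K`, the largest sum of grid indices;  `12`: `2 * N + 1`, the number of bins;
  `13`: `2 * N * K + 1`, the number of sums;
* `14`–`16`: counters, from the outermost to the innermost loop;  `17`: accumulator.

Array `4` holds the distribution of the sum of the grid indices, array `5` the bins. If the trivial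
bounds `0` and `K * scale` for the optimal value are good enough, the output is `0`. -/
def transportProgram : Program :=
  .seq scanProgram <|
  .seq (.assign 9 (.reg 0 * .reg 7)) <|
  .branch (.reg 3) (.reg 9) approximationProgram (.assign 4 (.const 0))

/-- The memory contains the instance `D`. -/
structure Holds (D : FlatInstance) (s : State) : Prop where
  K : s.reg 0 = D.K
  L : s.reg 1 = D.L
  t : s.reg 2 = D.t
  ε : s.reg 3 = D.ε
  p : s.arr 0 = D.p
  x : s.arr 1 = D.x
  y : ∀ j : Fin 2, s.arr (2 + j) = D.y j

variable {D : FlatInstance} {u N β : ℕ} {s s' : State}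

theorem Holds.congr (hs : Holds D s) (h : s.AgreesBelow 4 4 s') : Holds D s' where
  K := (h.1 0 (by omega)).trans hs.K
  L := (h.1 1 (by omega)).trans hs.L
  t := (h.1 2 (by omega)).trans hs.t
  ε := (h.1 3 (by omega)).trans hs.ε
  p := (h.2 0 (by omega)).trans hs.p
  x := (h.2 1 (by omega)).trans hs.x
  y j := (h.2 (2 + j) (by omega)).trans (hs.y j)

section Scan

variable (hD : D.IsValid (2 ^ u)) (hβ : D.K * D.L * (u + 1) ≤ β)
include hD hβ

theorem Holds.computes_sqDev (hs : Holds D s) {atom marginal : Term} {n : ℕ} (j : Fin 2)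
    (hatom : atom.Computes (40 * β) s n)
    (hmarginal : marginal.Computes (40 * β) s (n / D.L : ℕ)) :
    (sqDev j atom marginal).Computes (40 * β) s (D.dev j n ^ 2) := by
  obtain ⟨-, -, hu⟩ := hD.le_of_size_le hβ
  have hdev : (Term.cell 1 atom - .cell (2 + j) marginal).Computes (40 * β) s (D.dev j n) :=
    (hatom.cell (congrFun hs.x n)).sub (hmarginal.cell (congrFun (hs.y j) _))
      ((hD.fitsBits_dev j n).mono (by omega))
  exact hdev.mul_self ((hD.fitsBits_dev_sq j n).mono (by omega))

theorem computes_scanMarginal (hs : Holds D s) {n : ℕ} (hn : n < D.K * D.L) (h6 : s.reg 6 = n) :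
    scanMarginal.Computes (40 * β) s (n / D.L : ℕ) := by
  obtain ⟨-, hL, _⟩ := hD.le_of_size_le hβ
  have hnβ : n < 2 ^ β := (hn.trans_le ((Nat.le_mul_of_pos_right _ u.succ_pos).trans hβ)).trans
    β.lt_two_pow_self
  rw [← Nat.floor_div_eq_div (K := ℚ)]
  refine ((Term.Computes.reg h6).div (.reg hs.L) ?_).floor_of_nonneg (by positivity) ?_
  · exact ((FitsBits.natCast hnβ.le).div
      (FitsBits.natCast (hL.trans β.lt_two_pow_self.le))).mono (by omega)
  · rw [Nat.floor_div_eq_div]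
    exact (Nat.div_le_self _ _).trans (hnβ.le.trans (Nat.pow_le_pow_right two_pos (by omega)))

theorem scanStep_achieves (hs : Holds D s) {n : ℕ} (hn : n < D.K * D.L) (h6 : s.reg 6 = n)
    (h7 : s.reg 7 = D.maxSqSum n) (h8 : s.reg 8 = D.meanCost n) :
    Achieves (40 * β) scanStep s 65 fun s' =>
      s.AgreesBelow 7 6 s' ∧ s'.reg 7 = D.maxSqSum (n + 1) ∧ s'.reg 8 = D.meanCost (n + 1) := by
  obtain ⟨-, -, hu⟩ := hD.le_of_size_le hβ
  have hsqSum := (hD.fitsBits_sqSum n).mono (show 8 * u + 5 ≤ 40 * β by omega)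
  have hsq (j : Fin 2) {s' : State} (hs' : s.AgreesBelow 7 6 s') :
      (sqDev j (.reg 6) scanMarginal).Computes (40 * β) s' (D.dev j n ^ 2) := by
    have hs'D := hs.congr (hs'.mono (by omega) (by omega))
    have h6' := (hs'.1 6 (by omega)).trans h6
    exact hs'D.computes_sqDev hD hβ j (.reg h6') (computes_scanMarginal hD hβ hs'D hn h6')
  have hmax := (State.AgreesBelow.refl (r := 7) (a := 6) s).setReg le_rfl (D.maxSqSum (n + 1))
  have hcost : D.meanCost n + D.p n * D.dev 1 n ^ 2 = D.meanCost (n + 1) :=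
    (Finset.sum_range_succ _ n).symm
  have hmeanCost := (hD.fitsBits_meanCost hβ hn).mono (show 5 * β ≤ 40 * β by omega)
  refine (Achieves.seq (n' := 15) (.assignMax (Post := (· = s.setReg 7 (D.maxSqSum (n + 1)))) h7
    ((hsq 0 (.refl s)).add (hsq 1 (.refl s)) hsqSum) hsqSum ?_) ?_).mono ?_ fun _ => id
  · rw [FlatInstance.maxSqSum_succ, FlatInstance.sqSum]
  · rintro _ rfl
    have hread : (Term.cell 0 (.reg 6)).Computes (40 * β) _ (D.p n) :=
      .cell (.reg ((hmax.1 6 (by omega)).trans h6))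
        (congrFun (hs.congr (hmax.mono (by omega) (by omega))).p n)
    refine .assign (((Term.Computes.reg (by simpa using h8)).add (hread.mul (hsq 1 hmax) ?_)
      ?_)) ?_ ⟨hmax.setReg (by omega) _, by simp, by simp [hcost]⟩
    · exact (FitsBits.mul (hD.p_bounded n) (hD.fitsBits_dev_sq 1 n)).mono (by omega)
    all_goals rwa [hcost]
  · simp [sqDev, scanMarginal]

theorem scanProgram_achieves (hs : Holds D s) :
    Achieves (40 * β) scanProgram s (D.K * D.L * 68 + 7) fun s' =>
      s.AgreesBelow 5 6 s' ∧ s'.reg 7 = D.scale ∧ s'.reg 8 = D.meanCost (D.K * D.L) := by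
  have hKL : D.K * D.L ≤ 2 ^ (40 * β) := by
    have := (Nat.le_mul_of_pos_right _ u.succ_pos).trans hβ
    exact this.trans (β.lt_two_pow_self.le.trans (Nat.pow_le_pow_right two_pos (by omega)))
  have hinit : s.AgreesBelow 5 6
      (((s.setReg 5 (D.K * D.L : ℕ)).setReg 7 0).setReg 8 0) :=
    (((State.AgreesBelow.refl s).setReg le_rfl _).setReg (by omega) _).setReg (by omega) _
  refine (Achieves.assign_seq (.mul_natCast (.reg hs.K) (.reg hs.L) hKL) (.natCast hKL) <|
    .assign_seq .const .zero <| .assign_seq .const .zero <|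
    .forLoop (n := 65) (a := 6) (J := D.K * D.L)
      (fun n s => s.reg 7 = D.maxSqSum n ∧ s.reg 8 = D.meanCost n)
      (by omega) (by simp) hKL (by simp) (by simp [FlatInstance.maxSqSum, FlatInstance.meanCost])
      fun n hn s' hs' h6 h => scanStep_achieves hD hβ (hs.congr ?_) hn h6 h.1 h.2).mono ?_ ?_
  · exact (hinit.mono (by omega) (by omega)).trans (hs'.mono (by omega) (by omega))
  · simp
    omega
  · exact fun s' hs' => ⟨hinit.trans (hs'.1.mono (by omega) le_rfl), hs'.2⟩

end Scan

end RatRam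

namespace RatRam

variable {D : FlatInstance} {u N β : ℕ} {s s' : State}

/-- The memory contains the instance `D` and the parameters that depend on the resolution `N`. -/
structure Ready (D : FlatInstance) (N : ℕ) (s : State) : Prop extends Holds D s where
  scale : s.reg 7 = D.scale
  meanCost : s.reg 8 = D.meanCost (D.K * D.L)
  resolution : s.reg 10 = N
  top : s.reg 11 = (2 * N * D.K : ℕ)
  bins : s.reg 12 = (2 * N + 1 : ℕ)
  sums : s.reg 13 = (2 * N * D.K + 1 : ℕ)

theorem Ready.congr (hs : Ready D N s) (h : s.AgreesBelow 14 4 s') : Ready D N s' where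
  toHolds := hs.toHolds.congr (h.mono (by omega) le_rfl)
  scale := (h.1 7 (by omega)).trans hs.scale
  meanCost := (h.1 8 (by omega)).trans hs.meanCost
  resolution := (h.1 10 (by omega)).trans hs.resolution
  top := (h.1 11 (by omega)).trans hs.top
  bins := (h.1 12 (by omega)).trans hs.bins
  sums := (h.1 13 (by omega)).trans hs.sums

theorem clearProgram_achieves {b n : ℕ} (hn : n ≤ 2 ^ b) (h12 : s.reg 12 = n) :
    Achieves b clearProgram s (n * 4 + 2) fun s' =>
      s.AgreesBelow 15 5 s' ∧ ∀ a < n, s'.arr 5 a = 0 := by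
  refine .forLoop (n := 1) (fun j s => ∀ a < j, s.arr 5 a = 0) (by omega) h12 hn (by simp)
    (by simp) fun j _ s' _ h15 h => ?_
  refine .store (.reg h15) .const .zero ⟨(State.AgreesBelow.refl _).setCell le_rfl _ _, ?_⟩
  intro a ha
  rw [State.arr_setCell, if_pos rfl, Function.update_apply]
  split_ifs with haj
  exacts [rfl, h a (by omega)]

section Convolve

variable {b n : ℕ} {f g : ℕ → ℚ} (hprod : ∀ a i, FitsBits b (f a * g i))
include hprod

theorem dotProgram_achieves {j : ℕ} (hsum : ∀ m ≤ n, FitsBits b (correlate m f g j))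
    (hjn : j + n ≤ 2 ^ b) (h12 : s.reg 12 = n) (h15 : s.reg 15 = j)
    (h5 : ∀ a < n, s.arr 5 a = f a) (h4 : ∀ a, s.arr 4 (j + a) = g (j + a)) :
    Achieves b dotProgram s (n * 9 + 3) fun s' =>
      s.AgreesBelow 16 6 s' ∧ s'.reg 17 = correlate n f g j := by
  have hinit : s.AgreesBelow 16 6 (s.setReg 17 0) := (State.AgreesBelow.refl s).setReg (by omega) 0
  refine (Achieves.assign_seq .const .zero <| .forLoop (n := 6) (a := 6)
    (fun m s => s.reg 17 = correlate m f g j) (by omega) (by simpa using h12) (by omega)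
    (by simp) (by simp [correlate]) fun m hm s' hs' h16 h17 => ?_).mono ?_ ?_
  · obtain ⟨hreg, harr⟩ := hinit.trans hs'
    have hnext : correlate m f g j + f m * g (j + m) = correlate (m + 1) f g j :=
      (Finset.sum_range_succ _ m).symm
    have hbin : (Term.cell 5 (.reg 16)).Computes b s' (f m) :=
      .cell (.reg h16) (by rw [harr 5 (by omega), h5 m hm])
    have hmass : (Term.cell 4 (.reg 15 + .reg 16)).Computes b s' (g (j + m)) :=
      .cell (.add_natCast (.reg ((hreg 15 (by omega)).trans h15)) (.reg h16) (by omega))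
        (by rw [harr 4 (by omega), h4])
    have hfit := hsum (m + 1) hm
    rw [← hnext] at hfit
    exact .assign ((Term.Computes.reg h17).add (hbin.mul hmass (hprod _ _)) hfit) hfit
      ⟨(State.AgreesBelow.refl _).setReg le_rfl _, by simp [hnext]⟩
  · simp
    omega
  · exact fun s' hs' => ⟨hinit.trans hs'.1, hs'.2⟩

theorem convolveProgram_achieves {m : ℕ} (hsum : ∀ n' ≤ n, ∀ j, FitsBits b (correlate n' f g j))
    (hmn : m + n ≤ 2 ^ b) (h12 : s.reg 12 = n) (h13 : s.reg 13 = m)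
    (h5 : ∀ a < n, s.arr 5 a = f a) (h4 : s.arr 4 = g) :
    Achieves b convolveProgram s (m * (n * 9 + 7) + 2) fun s' =>
      s.AgreesBelow 15 4 s' ∧ ∀ i, s'.arr 4 i = if i < m then correlate n f g i else g i := by
  refine (Achieves.forLoop (n := n * 9 + 4) (fun j s => (∀ a < n, s.arr 5 a = f a) ∧
      ∀ i, s.arr 4 i = if i < j then correlate n f g i else g i) (by omega) h13 (by omega)
      (by simp) ⟨h5, by simp [h4]⟩ ?_).mono le_rfl fun s' hs' => ⟨hs'.1, hs'.2.2⟩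
  rintro j hj s' hs' h15 ⟨h5', h4'⟩
  refine (dotProgram_achieves hprod (fun n' hn' => hsum n' hn' j) (by omega)
    ((hs'.1 12 (by omega)).trans h12) h15 h5' (fun a => by rw [h4', if_neg (by omega)])).seq
    (n' := 1) fun s'' hs'' => ?_
  obtain ⟨hagree, h17⟩ := hs''
  refine .store (.reg ((hagree.1 15 (by omega)).trans h15)) (.reg h17) (hsum n le_rfl j)
    ⟨(hagree.mono le_rfl (by omega)).setCell le_rfl _ _, fun a ha => ?_, fun i => ?_⟩
  · rw [State.arr_setCell, if_neg (by omega), hagree.2 5 (by omega), h5' a ha]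
  · rw [State.arr_setCell, if_pos rfl, Function.update_apply, hagree.2 4 (by omega), h4']
    grind

end Convolve

section Grid

variable (hD : D.IsValid (2 ^ u)) (hβ : D.K * D.L * (u + 1) ≤ β)
include hD hβ

theorem refineProgram_achieves (hs : Holds D s) (h9 : s.reg 9 = D.K * D.scale) {m : ℕ}
    (hlt : ∀ j < m, D.ε < D.K * D.scale / 2 ^ j) (hle : D.K * D.scale / 2 ^ m ≤ D.ε)
    (hm : m ≤ β) :
    Achieves (40 * β) refineProgram s (m * 5 + 2) fun s' =>
      s.AgreesBelow 9 6 s' ∧ s'.reg 10 = (2 ^ m : ℕ) := by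
  obtain ⟨hK, -, hu⟩ := hD.le_of_size_le hβ
  have hinit : s.AgreesBelow 9 6 (s.setReg 10 1) := (State.AgreesBelow.refl s).setReg (by omega) 1
  have hpow (j : ℕ) (hj : j ≤ m) : FitsBits β ((2 ^ j : ℕ) : ℚ) :=
    .natCast (Nat.pow_le_pow_right two_pos (hj.trans hm))
  have hbound (j : ℕ) (hj : j ≤ m) : FitsBits (40 * β) (D.K * D.scale / 2 ^ j) := by
    have := ((FitsBits.natCast (hK.trans β.lt_two_pow_self.le)).mul
      (hD.fitsBits_maxSqSum (D.K * D.L))).div (hpow j hj)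
    exact_mod_cast this.mono (by omega)
  refine (Achieves.assign_seq .const .one <|
    .loop (n := 4) (J := m) (fun j s' => s.AgreesBelow 9 6 s' ∧
      s'.reg 9 = D.K * D.scale / 2 ^ j ∧ s'.reg 10 = (2 ^ j : ℕ))
    ⟨hinit, by simp [h9], by simp⟩ ?_ ?_ ?_).mono ?_ fun s' hs' => ⟨hs'.1, hs'.2.2⟩
  · rintro j hj s' ⟨hs', h9, -⟩
    rw [h9, hs'.1 3 (by omega), hs.ε]
    exact hlt j hj
  · rintro s' ⟨hs', h9, -⟩
    rw [h9, hs'.1 3 (by omega), hs.ε]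
    exact hle.not_gt
  · rintro j hj s' ⟨hs', h9, h10⟩
    have hhalf : D.K * D.scale / 2 ^ j / 2 = D.K * D.scale / 2 ^ (j + 1) := by
      rw [div_div, pow_succ]
    have hdouble := (hpow (j + 1) hj).mono (show β ≤ 40 * β by omega)
    have hhalfFits := hbound (j + 1) hj
    rw [← hhalf] at hhalfFits
    refine (Achieves.assign_seq (v := (2 ^ (j + 1) : ℕ)) ?_ hdouble <|
      .assign (.div (.reg (by simpa using h9)) .const hhalfFits) hhalfFits
        ⟨(hs'.setReg (by omega) _).setReg le_rfl _, by simp [hhalf], by simp⟩)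
    rw [pow_succ]
    refine .mul_natCast (.reg h10) (by simpa using .const) ?_
    rw [← pow_succ]
    exact Nat.pow_le_pow_right two_pos (by omega)
  · simp
    omega

variable (hN : N ≤ 2 ^ β)

include hN in
theorem two_mul_numSums_le : 2 * (2 * N * D.K + 1) ≤ 2 ^ (40 * β) := by
  obtain ⟨-, -, hu⟩ := hD.le_of_size_le hβ
  calc 2 * (2 * N * D.K + 1) ≤ 2 ^ (4 * β + 1) := by
        rw [pow_succ']
        exact Nat.mul_le_mul_left _ (hD.two_mul_mul_lt_two_pow hβ hN).le
    _ ≤ 2 ^ (40 * β) := Nat.pow_le_pow_right two_pos (by omega)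

include hN in
theorem setupProgram_achieves (hs : Holds D s) (h7 : s.reg 7 = D.scale)
    (h8 : s.reg 8 = D.meanCost (D.K * D.L)) (h10 : s.reg 10 = N) (h4 : s.arr 4 = 0) :
    Achieves (40 * β) setupProgram s 9 fun s' => Ready D N s' ∧ s'.arr 4 = D.sumMass N 0 := by
  have hsums := two_mul_numSums_le hD hβ hN
  have hbins : 2 * N ≤ 2 * N * D.K := Nat.le_mul_of_pos_right _ hD.K_pos
  have htwo {s : State} : (Term.const 2).Computes (40 * β) s (2 : ℕ) := by simpa using .const
  have hone {s : State} : (Term.const 1).Computes (40 * β) s (1 : ℕ) := by simpa using .const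
  refine (Achieves.assign_seq (.mul_natCast (.mul_natCast htwo (.reg h10) (by omega))
      (.reg hs.K) (by omega)) (.natCast (by omega)) <|
    .assign_seq (.add_natCast (.mul_natCast htwo (.reg (by simpa using h10)) (by omega))
      hone (by omega)) (.natCast (by omega)) <|
    .assign_seq (.add_natCast (m := 2 * N * D.K) (.reg (by simp)) hone (by omega))
      (.natCast (by omega)) <|
    .store (i := 2 * N * D.K) (.reg (by simp)) .const .one ⟨⟨hs.congr ?_, ?_, ?_, ?_, ?_, ?_, ?_⟩,
      ?_⟩).mono (by simp) fun _ => id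
  · exact ((((State.AgreesBelow.refl s).setReg (by omega) _).setReg (by omega) _).setReg
      (by omega) _).setCell le_rfl _ _
  · simpa using h7
  · simpa using h8
  · simpa using h10
  · simp
  · simp
  · simp
  · funext j
    simp [h4, FlatInstance.sumMass, Function.update_apply]

section Bin

variable {k l : ℕ} (hs : Ready D N s) (hk : k < D.K) (hl : l < D.L) (h14 : s.reg 14 = k)
  (h15 : s.reg 15 = l)
include hs hk hl h14 h15

omit hD in
theorem computes_binAtom : binAtom.Computes (40 * β) s (k * D.L + l : ℕ) := by
  have hindex : k * D.L + l ≤ 2 ^ (40 * β) := by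
    have := (FlatInstance.index_lt hk hl).le.trans ((Nat.le_mul_of_pos_right _ u.succ_pos).trans hβ)
    exact this.trans (β.lt_two_pow_self.le.trans (Nat.pow_le_pow_right two_pos (by omega)))
  exact .add_natCast (.mul_natCast (.reg h14) (.reg hs.L) (by omega)) (.reg h15) hindex

include hN in
theorem computes_binIndex : binIndex.Computes (40 * β) s (D.grid N (k * D.L + l)) := by
  obtain ⟨-, -, hu⟩ := hD.le_of_size_le hβ
  have hn := FlatInstance.index_lt hk hl
  have hNfits : FitsBits β (N : ℚ) := .natCast hN
  have hmarginal : (Term.reg 14).Computes (40 * β) s ((k * D.L + l) / D.L : ℕ) := by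
    rw [FlatInstance.index_div hl]
    exact .reg h14
  have hsq (j : Fin 2) :=
    hs.toHolds.computes_sqDev hD hβ j (computes_binAtom hβ hs hk hl h14 h15) hmarginal
  have hgap := hD.fitsBits_gap (k * D.L + l)
  have hscaled := hgap.mul hNfits
  have hratio := hscaled.div (hD.fitsBits_maxSqSum (D.K * D.L))
  have hgrid := FlatInstance.grid_le N hn
  refine .floor_of_nonneg (((((hsq 0).sub (hsq 1) (hgap.mono (by omega))).mul (.reg hs.resolution)
    (hscaled.mono (by omega))).div (.reg hs.scale) (hratio.mono (by omega))).add
    (.reg hs.resolution) ((hratio.add hNfits).mono (by omega)))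
    (FlatInstance.gap_mul_div_add_mem_Icc N hn).1 (hgrid.trans ?_)
  calc 2 * N ≤ 2 ^ (β + 1) := by rw [pow_succ]; omega
    _ ≤ 2 ^ (40 * β) := Nat.pow_le_pow_right two_pos (by omega)

end Bin

include hN

theorem binProgram_achieves {k : ℕ} (hs : Ready D N s) (hk : k < D.K) (h14 : s.reg 14 = k)
    (h5 : ∀ a < 2 * N + 1, s.arr 5 a = 0) :
    Achieves (40 * β) binProgram s (D.L * 63 + 2) fun s' =>
      s.AgreesBelow 15 5 s' ∧ ∀ a < 2 * N + 1, s'.arr 5 a = D.binMass N k D.L a := by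
  obtain ⟨-, hL, -⟩ := hD.le_of_size_le hβ
  refine .forLoop (n := 60) (fun l s => ∀ a < 2 * N + 1, s.arr 5 a = D.binMass N k l a) (by omega)
    hs.L (hL.trans (β.lt_two_pow_self.le.trans (Nat.pow_le_pow_right two_pos (by omega))))
    (by simp) (by simpa [FlatInstance.binMass] using h5) fun l hl s' hs' h15 h => ?_
  have hready := hs.congr (hs'.mono (by omega) (by omega))
  have h14' := (hs'.1 14 (by omega)).trans h14
  have hindex := computes_binIndex hD hβ hN hready hk hl h14' h15
  have hatom := computes_binAtom hβ hready hk hl h14' h15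
  have hbin (a : ℕ) : D.binMass N k (l + 1) a = D.binMass N k l a +
      if D.grid N (k * D.L + l) = a then D.p (k * D.L + l) else 0 :=
    Finset.sum_range_succ _ l
  have hfits := (hD.fitsBits_binMass hβ N k (D.grid N (k * D.L + l)) hl).mono
    (show β ≤ 40 * β by omega)
  rw [hbin, if_pos rfl] at hfits
  have hgrid := FlatInstance.grid_le N (FlatInstance.index_lt hk hl)
  refine (Achieves.store hindex ((hindex.cell (h _ (by omega))).add
    (hatom.cell (congrFun hready.p _)) hfits) hfits
    ⟨(State.AgreesBelow.refl _).setCell le_rfl _ _, fun a ha => ?_⟩).mono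
    (by simp [binIndex, binAtom, sqDev]) fun _ => id
  rw [State.arr_setCell, if_pos rfl, Function.update_apply, hbin]
  split_ifs with heq hne hne
  exacts [by rw [heq], absurd heq.symm hne, absurd hne.symm heq, by rw [h a ha, add_zero]]

theorem sumProgram_achieves (hs : Ready D N s) (h4 : s.arr 4 = D.sumMass N 0) :
    Achieves (40 * β) sumProgram s
      (D.K * (((2 * N + 1) * 4 + 2) + (D.L * 63 + 2) +
        ((2 * N * D.K + 1) * ((2 * N + 1) * 9 + 7) + 2) + 3) + 2) fun s' =>
      s.AgreesBelow 14 4 s' ∧ s'.arr 4 = D.sumMass N D.K := by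
  obtain ⟨hK, -, -⟩ := hD.le_of_size_le hβ
  have hsums := two_mul_numSums_le hD hβ hN
  have hbins : 2 * N ≤ 2 * N * D.K := Nat.le_mul_of_pos_right _ hD.K_pos
  refine .forLoop (fun k s => s.arr 4 = D.sumMass N k) (by omega) hs.K
    (hK.trans (β.lt_two_pow_self.le.trans (Nat.pow_le_pow_right two_pos (by omega)))) (by simp) h4
    fun k hk s₀ hs₀ h14₀ hsum₀ => ?_
  have hready₀ := hs.congr hs₀
  rw [add_assoc]
  refine (clearProgram_achieves (b := 40 * β) (by omega) hready₀.bins).seq fun s₁ ⟨hs₁, hzero⟩ => ?_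
  have hready₁ := hready₀.congr (hs₁.mono (by omega) (by omega))
  have h14₁ := (hs₁.1 14 (by omega)).trans h14₀
  refine (binProgram_achieves hD hβ hN hready₁ hk h14₁ hzero).seq fun s₂ ⟨hs₂, hbin⟩ => ?_
  have hready₂ := hready₁.congr (hs₂.mono (by omega) (by omega))
  have hsum₂ := ((hs₂.2 4 (by omega)).trans (hs₁.2 4 (by omega))).trans hsum₀
  refine (convolveProgram_achieves (f := D.binMass N k D.L) (fun a i => ?_)
    (fun n' _ j => (hD.fitsBits_correlate hβ hk N n' j).mono (by omega)) (by omega)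
    hready₂.bins hready₂.sums hbin hsum₂).mono le_rfl fun s₃ ⟨hs₃, hsum₃⟩ => ⟨?_, ?_⟩
  · exact ((hD.fitsBits_binMass hβ N k a le_rfl).mul (hD.fitsBits_sumMass hβ hk.le N i)).mono
      (by omega)
  · exact ((hs₁.trans hs₂).mono le_rfl (by omega)).trans hs₃
  · funext i
    rw [hsum₃]
    split_ifs with hi
    · rfl
    · rw [FlatInstance.sumMass_eq_zero N k (by omega),
        FlatInstance.sumMass_eq_zero N (k + 1) (by omega)]

theorem evalStep_achieves (hs : Ready D N s) {j : ℕ} (hj : j < 2 * N * D.K)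
    (h4 : s.arr 4 = D.sumMass N D.K) (h14 : s.reg 14 = j) (h15 : s.reg 15 = D.cumMass N j)
    (h16 : s.reg 16 = D.truncSum N j) :
    Achieves (40 * β) evalStep s 7 fun s' => s.AgreesBelow 15 6 s' ∧
      s'.reg 15 = D.cumMass N (j + 1) ∧ s'.reg 16 = D.truncSum N (j + 1) := by
  have hsums := two_mul_numSums_le hD hβ hN
  have hindex : (Term.reg 11 - .reg 14).Computes (40 * β) s (2 * N * D.K - j : ℕ) := by
    have hfit := FitsBits.natCast (n := 2 * N * D.K - j) (b := 40 * β) (by omega)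
    rw [Nat.cast_sub hj.le] at hfit ⊢
    exact (Term.Computes.reg hs.top).sub (.reg h14) hfit
  have hcumFits := (hD.fitsBits_cumMass hβ hN (Nat.succ_le_of_lt hj)).mono
    (show 5 * β ≤ 40 * β by omega)
  have htruncFits := (hD.fitsBits_truncSum hβ hN (Nat.succ_le_of_lt hj)).mono
    (show 6 * β ≤ 40 * β by omega)
  have hcum : (Term.reg 15 + .cell 4 (.reg 11 - .reg 14)).Computes (40 * β) s
      (D.cumMass N (j + 1)) := by
    rw [FlatInstance.cumMass, Finset.sum_range_succ] at hcumFits ⊢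
    exact (Term.Computes.reg h15).add (hindex.cell (congrFun h4 _)) hcumFits
  have hset := (State.AgreesBelow.refl (r := 15) (a := 6) s).setReg le_rfl (D.cumMass N (j + 1))
  have haddTrunc (r : ℕ) (hr : (s.setReg 15 (D.cumMass N (j + 1))).reg r =
      min D.t (D.cumMass N (j + 1))) :
      Achieves (40 * β) (.assign 16 (.reg 16 + .reg r)) (s.setReg 15 (D.cumMass N (j + 1))) 2
        fun s' => s.AgreesBelow 15 6 s' ∧ s'.reg 15 = D.cumMass N (j + 1) ∧
          s'.reg 16 = D.truncSum N (j + 1) := by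
    refine .assign (v := D.truncSum N (j + 1)) ?_ htruncFits
      ⟨hset.setReg (by omega) _, by simp, by simp⟩
    rw [FlatInstance.truncSum, Finset.sum_range_succ] at htruncFits ⊢
    exact .add (.reg (by simpa [FlatInstance.truncSum] using h16)) (.reg hr) htruncFits
  refine (Achieves.assign_seq hcum hcumFits (.branch (.reg (by simpa using hs.t))
    (.reg (by simp; rfl)) (fun hlt => haddTrunc 2 ?_) fun hlt => haddTrunc 15 ?_)).mono
    (by simp) fun _ => id
  · simpa [min_eq_left hlt.le] using hs.t
  · simp [min_eq_right (not_lt.1 hlt)]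

theorem evalProgram_achieves (hs : Ready D N s) (h4 : s.arr 4 = D.sumMass N D.K) :
    Achieves (40 * β) evalProgram s (2 * N * D.K * 10 + 11) fun s' =>
      s'.output = D.approxValue N := by
  have hsums := two_mul_numSums_le hD hβ hN
  have hinit : s.AgreesBelow 14 6 ((s.setReg 15 0).setReg 16 0) :=
    ((State.AgreesBelow.refl s).setReg (by omega) 0).setReg (by omega) 0
  refine (Achieves.assign_seq .const .zero <| .assign_seq .const .zero <|
    (Achieves.forLoop (n := 7) (a := 6) (J := 2 * N * D.K)
      (fun j s => s.reg 15 = D.cumMass N j ∧ s.reg 16 = D.truncSum N j) (by omega)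
      (by simpa using hs.top) (by omega) (by simp)
      (by simp [FlatInstance.cumMass, FlatInstance.truncSum]) fun j hj s' hs' h14 h => ?_).seq
      (n' := 7) fun s' hs' => ?_).mono ?_ fun _ => id
  · have hs' := hinit.trans hs'
    exact evalStep_achieves hD hβ hN (hs.congr (hs'.mono le_rfl (by omega))) hj
      ((hs'.2 4 (by omega)).trans h4) h14 h.1 h.2
  · obtain ⟨hs', -, htrunc⟩ := hs'
    obtain ⟨hK, -, hu⟩ := hD.le_of_size_le hβ
    have hs' := hs.congr ((hinit.trans hs').mono le_rfl (by omega))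
    have hmean := hD.fitsBits_meanCost hβ le_rfl
    have hNfits : FitsBits β (N : ℚ) := .natCast hN
    have hstep := (hD.fitsBits_maxSqSum (D.K * D.L)).div hNfits
    have hKN := (FitsBits.natCast (hK.trans β.lt_two_pow_self.le)).mul hNfits
    have hKNt : FitsBits (2 * β + u) (D.K * N * D.t) := (hKN.mul hD.t_bounded).mono (by omega)
    have hdiff := hKNt.sub (hD.fitsBits_truncSum hβ hN le_rfl)
    have hprod := hstep.mul hdiff
    have hvalue := hmean.add hprod
    refine .assign (.add (.reg hs'.meanCost) (.mul (.div (.reg hs'.scale) (.reg hs'.resolution)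
      (hstep.mono (by omega))) (.sub (.mul (.mul (.reg hs'.K) (.reg hs'.resolution)
      (hKN.mono (by omega))) (.reg hs'.t) (hKNt.mono (by omega))) (.reg htrunc)
      (hdiff.mono (by omega))) (hprod.mono (by omega))) (hvalue.mono (by omega)))
      (hvalue.mono (by omega)) (by simp [State.output, FlatInstance.approxValue])
  · simp
    omega

end Grid

section Transport

variable {m : ℕ}

theorem approximationCost_le {K : ℕ} (hK : 0 < K) (L m : ℕ) :
    m * 5 + 2 + (9 + (K * ((2 * 2 ^ m + 1) * 4 + 2 + (L * 63 + 2) +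
      ((2 * 2 ^ m * K + 1) * ((2 * 2 ^ m + 1) * 9 + 7) + 2) + 3) + 2 + (2 * 2 ^ m * K * 10 + 11)))
      ≤ 300 * (K * L + K ^ 2 * (2 ^ m) ^ 2) := by
  have hmN : m ≤ 2 ^ m := Nat.lt_two_pow_self.le
  have hN : 1 ≤ 2 ^ m := Nat.one_le_two_pow
  generalize 2 ^ m = N at hmN hN ⊢
  have hK_le : K ≤ K * N := Nat.le_mul_of_pos_right _ hN
  have hN_le : N ≤ K * N := Nat.le_mul_of_pos_left _ hK
  have hKN_le : K * N ≤ K ^ 2 * N ^ 2 := by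
    rw [← mul_pow]
    exact Nat.le_self_pow two_ne_zero _
  have hKKN_le : K ^ 2 * N ≤ K ^ 2 * N ^ 2 :=
    Nat.mul_le_mul_left _ (Nat.le_self_pow two_ne_zero _)
  nlinarith

variable (hD : D.IsValid (2 ^ u)) (hβ : D.K * D.L * (u + 1) ≤ β)
  (hlt : ∀ j < m, D.ε < D.K * D.scale / 2 ^ j) (hle : D.K * D.scale / 2 ^ m ≤ D.ε) (hm : m ≤ β)
include hD hβ hlt hle hm

theorem approximationProgram_achieves (hs : Holds D s) (h4 : s.arr 4 = 0)
    (h7 : s.reg 7 = D.scale) (h8 : s.reg 8 = D.meanCost (D.K * D.L))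
    (h9 : s.reg 9 = D.K * D.scale) :
    Achieves (40 * β) approximationProgram s (300 * (D.K * D.L + D.K ^ 2 * (2 ^ m) ^ 2))
      fun s' => s'.output = D.approxValue (2 ^ m) := by
  have hN : 2 ^ m ≤ 2 ^ β := Nat.pow_le_pow_right two_pos hm
  refine ((refineProgram_achieves hD hβ hs h9 hlt hle hm).seq fun s₁ h₁ => ?_).mono
    (approximationCost_le hD.K_pos D.L m) fun _ => id
  obtain ⟨h₁, h10⟩ := h₁
  refine (setupProgram_achieves hD hβ hN (hs.congr (h₁.mono (by omega) (by omega)))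
    ((h₁.1 7 (by omega)).trans h7) ((h₁.1 8 (by omega)).trans h8) h10
    ((h₁.2 4 (by omega)).trans h4)).seq fun s₂ h₂ => ?_
  refine (sumProgram_achieves hD hβ hN h₂.1 h₂.2).seq fun s₃ h₃ => ?_
  exact evalProgram_achieves hD hβ hN (h₂.1.congr h₃.1) h₃.2

theorem transportProgram_achieves (hs : Holds D s) (h4 : s.arr 4 = 0) :
    Achieves (40 * β) transportProgram s
      (D.K * D.L * 68 + 12 +
        if D.ε < D.K * D.scale then 300 * (D.K * D.L + D.K ^ 2 * (2 ^ m) ^ 2) else 0)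
      fun s' => s'.output = if D.ε < D.K * D.scale then D.approxValue (2 ^ m) else 0 := by
  obtain ⟨hK, -, hu⟩ := hD.le_of_size_le hβ
  have hbound : FitsBits (40 * β) (D.K * D.scale) :=
    ((FitsBits.natCast (hK.trans β.lt_two_pow_self.le)).mul
      (hD.fitsBits_maxSqSum (D.K * D.L))).mono (by omega)
  refine ((scanProgram_achieves hD hβ hs).seq (n' := 5 + if D.ε < D.K * D.scale then
    300 * (D.K * D.L + D.K ^ 2 * (2 ^ m) ^ 2) else 0) fun s₁ h => ?_).mono (by omega) fun _ => id
  obtain ⟨h₁, h7, h8⟩ := h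
  have h₂ : s.AgreesBelow 5 5 (s₁.setReg 9 (D.K * D.scale)) :=
    (h₁.mono le_rfl (by omega)).setReg (by omega) _
  have hs₂ := hs.congr (h₂.mono (by omega) (by omega))
  refine (Achieves.assign_seq (.mul (.reg ((h₁.1 0 (by omega)).trans hs.K)) (.reg h7) hbound)
    hbound (.branch (n := 1 + if D.ε < D.K * D.scale then
      300 * (D.K * D.L + D.K ^ 2 * (2 ^ m) ^ 2) else 0) (.reg hs₂.ε) (.reg (by simp; rfl))
      (fun hε => ?_) fun hε => ?_)).mono (by simp; omega) fun _ => id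
  · simp only [if_pos hε]
    exact (approximationProgram_achieves hD hβ hlt hle hm hs₂ ((h₂.2 4 (by omega)).trans h4)
      (by simpa using h7) (by simpa using h8) (by simp)).mono (by omega) fun _ => id
  · simp only [if_neg hε]
    exact .assign .const .zero (by simp [State.output])

end Transport

end RatRam

/-! ### Transport to a two-point distribution -/

section Transport

variable {E I J : Type*} [Fintype I] [Fintype J] {c : E → E → ℝ} {μ : I → ℝ} {x : I → E}

theorem mul_mem_transportPlans {ν : J → ℝ} (hμ : μ ∈ stdSimplex ℝ I) (hν : ν ∈ stdSimplex ℝ J) :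
    (fun i j => μ i * ν j) ∈ transportPlans μ ν := by
  refine ⟨fun i j => mul_nonneg (hμ.1 i) (hν.1 j), fun i => ?_, fun j => ?_⟩
  · rw [← Finset.mul_sum, hν.2, mul_one]
  · rw [← Finset.sum_mul, hμ.2, one_mul]

theorem optimalTransport_mem_Icc {ν : J → ℝ} {y : J → E} {A B : ℝ} (hμ : μ ∈ stdSimplex ℝ I)
    (hν : ν ∈ stdSimplex ℝ J) (hc : ∀ i j, c (x i) (y j) ∈ Set.Icc A B) :
    optimalTransport c μ x ν y ∈ Set.Icc A B := by
  have hcost : ∀ w ∈ (fun π : I → J → ℝ => ∑ i, ∑ j, c (x i) (y j) * π i j) '' transportPlans μ ν,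
      w ∈ Set.Icc A B := by
    rintro _ ⟨π, ⟨hπ, hrow, -⟩, rfl⟩
    have hmass (b : ℝ) : ∑ i, ∑ j, b * π i j = b := by
      simp only [← Finset.mul_sum, hrow, hμ.2, mul_one]
    constructor
    · refine (hmass A).symm.le.trans (Finset.sum_le_sum fun i _ => Finset.sum_le_sum fun j _ => ?_)
      exact mul_le_mul_of_nonneg_right (hc i j).1 (hπ i j)
    · refine le_trans (Finset.sum_le_sum fun i _ => Finset.sum_le_sum fun j _ => ?_) (hmass B).le
      exact mul_le_mul_of_nonneg_right (hc i j).2 (hπ i j)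
  have hplan := Set.mem_image_of_mem (fun π : I → J → ℝ => ∑ i, ∑ j, c (x i) (y j) * π i j)
    (mul_mem_transportPlans hμ hν)
  exact ⟨le_csInf ⟨_, hplan⟩ fun w hw => (hcost w hw).1,
    (csInf_le ⟨A, fun w hw => (hcost w hw).1⟩ hplan).trans (hcost _ hplan).2⟩

/-- The mass distributions dominated by `μ` of total mass `t`: the first columns of the transport
plans from a probability distribution `μ` to a two-point distribution with weights `t`, `1 - t`. -/
def subMasses (μ : I → ℝ) (t : ℝ) : Set (I → ℝ) :=
  {φ | (∀ i, φ i ∈ Set.Icc 0 (μ i)) ∧ ∑ i, φ i = t}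

theorem optimalTransport_two_point (hμ : ∑ i, μ i = 1) (t : ℝ) (y₁ y₂ : E) :
    optimalTransport c μ x ![t, 1 - t] ![y₁, y₂] =
      sInf ((fun φ : I → ℝ => ∑ i, μ i * c (x i) y₂ + ∑ i, φ i * (c (x i) y₁ - c (x i) y₂)) ''
        subMasses μ t) := by
  have hcost {π : I → Fin 2 → ℝ} (hπ : ∀ i, ∑ j, π i j = μ i) :
      ∑ i, ∑ j, c (x i) (![y₁, y₂] j) * π i j =
        ∑ i, μ i * c (x i) y₂ + ∑ i, π i 0 * (c (x i) y₁ - c (x i) y₂) := by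
    rw [← Finset.sum_add_distrib]
    refine Finset.sum_congr rfl fun i _ => ?_
    simp only [← hπ i, Fin.sum_univ_two, Matrix.cons_val_zero, Matrix.cons_val_one]
    ring
  rw [optimalTransport]
  congr 1
  ext w
  constructor
  · rintro ⟨π, ⟨hπ, hrow, hcol⟩, rfl⟩
    refine ⟨fun i => π i 0, ⟨fun i => ⟨hπ i 0, ?_⟩, hcol 0⟩, (hcost hrow).symm⟩
    rw [← hrow i, Fin.sum_univ_two]
    exact le_add_of_nonneg_right (hπ i 1)
  · rintro ⟨φ, ⟨hφ, hsum⟩, rfl⟩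
    have hrow (i : I) : ∑ j, ![φ i, μ i - φ i] j = μ i := by simp
    refine ⟨fun i => ![φ i, μ i - φ i], ⟨fun i j => ?_, hrow, fun j => ?_⟩, hcost hrow⟩
    · fin_cases j
      exacts [(hφ i).1, sub_nonneg.2 (hφ i).2]
    · fin_cases j <;> simp [hsum, hμ]

theorem sum_mul_natCast_eq {R : Type*} [CommRing R] {S : I → ℕ} {M : ℕ} (hS : ∀ i, S i ≤ M)
    (φ : I → R) :
    ∑ i, φ i * S i = M * ∑ i, φ i - ∑ s ∈ Finset.range M, ∑ i with S i ≤ s, φ i := by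
  simp only [Finset.sum_filter]
  rw [Finset.sum_comm, Finset.mul_sum, ← Finset.sum_sub_distrib]
  refine Finset.sum_congr rfl fun i _ => ?_
  have hcard : ((Finset.range M).filter (S i ≤ ·)).card = M - S i := by
    rw [← Nat.card_Ico]
    congr 1
    ext s
    simp [and_comm]
  rw [← Finset.sum_filter, Finset.sum_const, hcard, nsmul_eq_mul, Nat.cast_sub (hS i)]
  ring

theorem exists_sum_filter_lt_le_le {S : I → ℕ} {t : ℝ} (ht : 0 ≤ t) (ht' : t ≤ ∑ i, μ i) :
    ∃ n, ∑ i with S i < n, μ i ≤ t ∧ t ≤ ∑ i with S i < n + 1, μ i := by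
  have hex : ∃ n, t ≤ ∑ i with S i < n + 1, μ i := by
    refine ⟨Finset.univ.sup S, ht'.trans_eq ?_⟩
    rw [Finset.filter_true_of_mem fun i hi => Nat.lt_succ_of_le (Finset.le_sup hi)]
  classical
  refine ⟨Nat.find hex, ?_, Nat.find_spec hex⟩
  rcases hn : Nat.find hex with _ | n
  · simpa using ht
  · exact (not_le.1 (Nat.find_min hex (hn ▸ n.lt_succ_self))).le

/-- The greedy choice: exhaust the points with small `S` first. -/
theorem exists_mem_subMasses_sum_filter_eq_min (hμ : ∀ i, 0 ≤ μ i) {t : ℝ} (ht : 0 ≤ t)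
    (ht' : t ≤ ∑ i, μ i) (S : I → ℕ) :
    ∃ φ ∈ subMasses μ t, ∀ n, ∑ i with S i < n, φ i = min t (∑ i with S i < n, μ i) := by
  obtain ⟨m, hm, hm'⟩ := exists_sum_filter_lt_le_le (S := S) ht ht'
  obtain ⟨a, b, ha, hb, hab, ht_eq⟩ :
      t ∈ segment ℝ (∑ i with S i < m, μ i) (∑ i with S i < m + 1, μ i) := by
    rw [segment_eq_Icc (hm.trans hm')]
    exact ⟨hm, hm'⟩
  have hmono {n n' : ℕ} (h : n ≤ n') : ∑ i with S i < n, μ i ≤ ∑ i with S i < n', μ i :=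
    Finset.sum_le_sum_of_subset_of_nonneg
      (Finset.monotone_filter_right _ fun i _ hi => hi.trans_le h) fun i _ _ => hμ i
  have hsum (s : Finset I) : ∑ i ∈ s, (a * (if S i < m then μ i else 0) +
      b * (if S i < m + 1 then μ i else 0)) =
        a * ∑ i ∈ s with S i < m, μ i + b * ∑ i ∈ s with S i < m + 1, μ i := by
    rw [Finset.sum_add_distrib, ← Finset.mul_sum, ← Finset.mul_sum, Finset.sum_filter,
      Finset.sum_filter]
  refine ⟨fun i => a * (if S i < m then μ i else 0) + b * (if S i < m + 1 then μ i else 0),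
    ⟨fun i => ?_, by rw [hsum, ← ht_eq, smul_eq_mul, smul_eq_mul]⟩, fun n => ?_⟩
  · have hite (n : ℕ) : (if S i < n then μ i else 0) ∈ Set.Icc 0 (μ i) := by
      split_ifs
      exacts [⟨hμ i, le_rfl⟩, ⟨le_rfl, hμ i⟩]
    exact convex_Icc 0 (μ i) (hite m) (hite (m + 1)) ha hb hab
  · have hmin (k : ℕ) : (Finset.univ.filter (S · < n)).filter (S · < k) =
        Finset.univ.filter (S · < min n k) := by
      simp only [Finset.filter_filter, lt_min_iff]
    rw [hsum, hmin, hmin]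
    rcases Nat.lt_or_ge m n with hn | hn
    · rw [min_eq_right hn.le, min_eq_right (Nat.succ_le_of_lt hn),
        min_eq_left (hm'.trans (hmono hn))]
      exact ht_eq
    · rw [min_eq_left hn, min_eq_left (hn.trans m.le_succ), ← add_mul, hab, one_mul,
        min_eq_right ((hmono hn).trans hm)]

theorem isLeast_sum_mul_natCast_subMasses (hμ : ∀ i, 0 ≤ μ i) {t : ℝ} (ht : 0 ≤ t)
    (ht' : t ≤ ∑ i, μ i) {S : I → ℕ} {M : ℕ} (hS : ∀ i, S i ≤ M) :
    IsLeast ((fun φ : I → ℝ => ∑ i, φ i * S i) '' subMasses μ t)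
      (M * t - ∑ s ∈ Finset.range M, min t (∑ i with S i ≤ s, μ i)) := by
  constructor
  · obtain ⟨φ, hφ, hmin⟩ := exists_mem_subMasses_sum_filter_eq_min hμ ht ht' S
    refine ⟨φ, hφ, ?_⟩
    simp only [sum_mul_natCast_eq hS, hφ.2, ← Nat.lt_add_one_iff, hmin]
  · rintro _ ⟨φ, ⟨hφ, hsum⟩, rfl⟩
    simp only [sum_mul_natCast_eq hS, hsum]
    refine sub_le_sub_left (Finset.sum_le_sum fun s _ => le_min ?_ ?_) _
    · rw [← hsum]
      exact Finset.sum_le_sum_of_subset_of_nonneg (Finset.filter_subset _ _) fun i _ _ => (hφ i).1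
    · exact Finset.sum_le_sum fun i _ => (hφ i).2

theorem abs_sInf_image_sub_le {α : Type*} {s : Set α} {F G : α → ℝ} {v η : ℝ}
    (hv : IsLeast (G '' s) v) (hFG : ∀ a ∈ s, |F a - G a| ≤ η) : |sInf (F '' s) - v| ≤ η := by
  obtain ⟨⟨a, ha, rfl⟩, hle⟩ := hv
  have hlower : ∀ w ∈ F '' s, G a - η ≤ w := by
    rintro _ ⟨b, hb, rfl⟩
    linarith [hle ⟨b, hb, rfl⟩, (abs_le.1 (hFG b hb)).1]
  have hleast := csInf_le ⟨_, hlower⟩ ⟨a, ha, rfl⟩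
  have hgreatest := le_csInf (Set.image_nonempty.2 ⟨a, ha⟩) hlower
  rw [abs_le]
  constructor <;> linarith [(abs_le.1 (hFG a ha)).2]

theorem abs_optimalTransport_two_point_sub_le (hμ : μ ∈ stdSimplex ℝ I) {t : ℝ}
    (ht : t ∈ Set.Icc 0 1) {S : I → ℕ} {M : ℕ} (hS : ∀ i, S i ≤ M) {y₁ y₂ : E} {a b η : ℝ}
    (ha : 0 ≤ a) (hc : ∀ i, |c (x i) y₁ - c (x i) y₂ - a * (S i - b)| ≤ η) :
    |optimalTransport c μ x ![t, 1 - t] ![y₁, y₂] - (∑ i, μ i * c (x i) y₂ +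
      a * (M * t - ∑ s ∈ Finset.range M, min t (∑ i with S i ≤ s, μ i) - b * t))| ≤ η := by
  have hleast := Monotone.map_isLeast
    (f := fun v => ∑ i, μ i * c (x i) y₂ + a * (v - b * t)) (fun v w hvw => by simp only; gcongr)
    (isLeast_sum_mul_natCast_subMasses hμ.1 ht.1 (ht.2.trans_eq hμ.2.symm) hS)
  rw [Set.image_image] at hleast
  rw [optimalTransport_two_point hμ.2]
  refine abs_sInf_image_sub_le hleast fun φ hφ => ?_
  have hdiff : ∑ i, φ i * (c (x i) y₁ - c (x i) y₂) - a * (∑ i, φ i * S i - b * t) =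
      ∑ i, φ i * (c (x i) y₁ - c (x i) y₂ - a * (S i - b)) := by
    rw [← hφ.2, Finset.mul_sum, ← Finset.sum_sub_distrib, Finset.mul_sum, ← Finset.sum_sub_distrib]
    exact Finset.sum_congr rfl fun i _ => by ring
  rw [add_sub_add_left_eq_sub, hdiff]
  calc |∑ i, φ i * (c (x i) y₁ - c (x i) y₂ - a * (S i - b))|
      ≤ ∑ i, |φ i * (c (x i) y₁ - c (x i) y₂ - a * (S i - b))| := Finset.abs_sum_le_sum_abs _ _
    _ ≤ ∑ i, μ i * η := by
        refine Finset.sum_le_sum fun i _ => ?_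
        rw [abs_mul, abs_of_nonneg (hφ.1 i).1]
        exact mul_le_mul (hφ.1 i).2 (hc i) (abs_nonneg _) (hμ.1 i)
    _ = η := by rw [← Finset.sum_mul, hμ.2, one_mul]

end Transport

/-! ### Accuracy of the computed value -/

section ProductDistribution

variable {ι R : Type*} [Fintype ι] [DecidableEq ι] {κ : ι → Type*} [∀ i, Fintype (κ i)]

theorem sum_prod_mul_apply [CommSemiring R] {p : ∀ i, κ i → R} (hp : ∀ i, ∑ l, p i l = 1) (i : ι)
    (f : κ i → R) : ∑ a : ∀ i, κ i, (∏ j, p j (a j)) * f (a i) = ∑ l, p i l * f l := by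
  have hfactor (a : ∀ i, κ i) : (∏ j, p j (a j)) * f (a i) =
      ∏ j, Function.update p i (fun l => p i l * f l) j (a j) := by
    rw [Fintype.prod_eq_mul_prod_compl i, Fintype.prod_eq_mul_prod_compl i,
      Function.update_self, mul_right_comm]
    congr 1
    refine Finset.prod_congr rfl fun j hj => ?_
    rw [Function.update_of_ne (by simpa using hj)]
  simp only [hfactor]
  rw [← Fintype.prod_sum, Fintype.prod_eq_single i, Function.update_self]
  intro j hj
  rw [Function.update_of_ne hj, hp]

theorem prod_mem_stdSimplex [CommSemiring R] [PartialOrder R] [IsOrderedRing R]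
    {p : ∀ i, κ i → R} (hp : ∀ i, p i ∈ stdSimplex R (κ i)) :
    (fun a : ∀ i, κ i => ∏ i, p i (a i)) ∈ stdSimplex R (∀ i, κ i) := by
  refine ⟨fun a => Finset.prod_nonneg fun i _ => (hp i).1 _, ?_⟩
  rw [← Fintype.prod_sum, Finset.prod_eq_one fun i _ => (hp i).2]

end ProductDistribution

theorem norm_sub_ratPoint_sq {K : ℕ} (v w : Fin K → ℚ) :
    ‖ratPoint v - ratPoint w‖ ^ 2 = ((∑ k, (v k - w k) ^ 2 : ℚ) : ℝ) := by
  simp [EuclideanSpace.norm_sq_eq, ratPoint]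

theorem sum_range_mul {M : Type*} [AddCommMonoid M] (K L : ℕ) (f : ℕ → M) :
    ∑ n ∈ Finset.range (K * L), f n = ∑ k : Fin K, ∑ l : Fin L, f (k * L + l) := by
  rw [Finset.sum_range, ← finProdFinEquiv.sum_comp, Fintype.sum_prod_type]
  simp [finProdFinEquiv, add_comm, mul_comm]

namespace FlatInstance

variable (D : FlatInstance)

/-- The atom of the product of the first `k` marginals with indices `i`, as a tuple of indices of
atoms of the marginals. -/
def index {k : ℕ} (i : Fin k → Fin D.L) (κ : Fin k) : ℕ :=
  κ * D.L + i κ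

/-- The probability of an atom of the product of the first `k` marginals. -/
def weight {k : ℕ} (i : Fin k → Fin D.L) : ℚ :=
  ∏ κ, D.p (D.index i κ)

/-- The sum of the grid indices of an atom of the product of the first `k` marginals. -/
def gridSum (N : ℕ) {k : ℕ} (i : Fin k → Fin D.L) : ℕ :=
  ∑ κ, D.grid N (D.index i κ)

/-- The optimal value of the transport problem described by the instance. -/
noncomputable def transportValue : ℝ :=
  productTwoPointOT (fun (k : Fin D.K) (l : Fin D.L) => D.p (k * D.L + l))
    (fun k l => D.x (k * D.L + l)) (fun k => D.y 0 k) (fun k => D.y 1 k) D.t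

variable {D}

theorem index_mem (i : Fin D.K → Fin D.L) (k : Fin D.K) : D.index i k < D.K * D.L :=
  index_lt k.2 (i k).2

theorem weight_snoc {k : ℕ} (i : Fin k → Fin D.L) (l : Fin D.L) :
    D.weight (Fin.snoc i l : Fin (k + 1) → Fin D.L) = D.p (k * D.L + l) * D.weight i := by
  simp [weight, index, Fin.prod_univ_castSucc, mul_comm]

theorem gridSum_snoc (N : ℕ) {k : ℕ} (i : Fin k → Fin D.L) (l : Fin D.L) :
    D.gridSum N (Fin.snoc i l : Fin (k + 1) → Fin D.L) =
      D.grid N (k * D.L + l) + D.gridSum N i := by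
  simp [gridSum, index, Fin.sum_univ_castSucc, add_comm]

theorem gridSum_le (N : ℕ) (i : Fin D.K → Fin D.L) : D.gridSum N i ≤ 2 * N * D.K := by
  simpa [gridSum, mul_comm] using
    Finset.sum_le_card_nsmul Finset.univ _ (2 * N) fun k _ => grid_le N (index_mem i k)

theorem sumMass_succ (N : ℕ) {k : ℕ} (hk : k < D.K) (j : ℕ) :
    D.sumMass N (k + 1) j =
      ∑ l : Fin D.L, D.p (k * D.L + l) * D.sumMass N k (j + D.grid N (k * D.L + l)) := by
  simp only [sumMass, correlate, binMass, Finset.sum_mul, ite_mul, zero_mul]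
  rw [Finset.sum_comm, Finset.sum_range]
  refine Finset.sum_congr rfl fun l _ => ?_
  rw [Finset.sum_ite_eq, if_pos]
  exact Finset.mem_range.2 (Nat.lt_succ_of_le (grid_le N (index_lt hk l.2)))

theorem sumMass_eq (N : ℕ) {k : ℕ} (hk : k ≤ D.K) (j : ℕ) :
    D.sumMass N k j =
      ∑ i : Fin k → Fin D.L with j + D.gridSum N i = 2 * N * D.K, D.weight i := by
  rw [Finset.sum_filter]
  induction k generalizing j with
  | zero => simp [sumMass, gridSum, weight]
  | succ k ih =>
    rw [sumMass_succ N hk, ← (Fin.snocEquiv fun _ => Fin D.L).sum_comp, Fintype.sum_prod_type]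
    have hsnoc (l : Fin D.L) (i : Fin k → Fin D.L) :
        (Fin.snocEquiv fun _ => Fin D.L) (l, i) = Fin.snoc i l := rfl
    simp only [ih (Nat.le_of_succ_le hk), Finset.mul_sum, mul_ite, mul_zero, add_assoc, hsnoc,
      weight_snoc, gridSum_snoc]

theorem cumMass_eq (N : ℕ) {j : ℕ} (hj : j ≤ 2 * N * D.K) :
    D.cumMass N j = ∑ i : Fin D.K → Fin D.L with D.gridSum N i < j, D.weight i := by
  simp only [cumMass, sumMass_eq N le_rfl, Finset.sum_filter]
  rw [Finset.sum_comm]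
  refine Finset.sum_congr rfl fun i _ => ?_
  calc ∑ s ∈ Finset.range j,
        (if 2 * N * D.K - s + D.gridSum N i = 2 * N * D.K then D.weight i else 0)
      = ∑ s ∈ Finset.range j, if D.gridSum N i = s then D.weight i else 0 := by
        refine Finset.sum_congr rfl fun s hs => if_congr ?_ rfl rfl
        have := Finset.mem_range.1 hs
        omega
    _ = if D.gridSum N i < j then D.weight i else 0 := by simp

theorem abs_gap_sub_le {N n : ℕ} (hN : N ≠ 0) (hn : n < D.K * D.L) :
    |D.gap n - D.scale / N * (D.grid N n - N)| ≤ D.scale / N := by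
  have hfloor : |D.gap n * N / D.scale + N - D.grid N n| ≤ 1 := by
    have hle := Nat.floor_le (gap_mul_div_add_mem_Icc N hn).1
    have hlt := Nat.lt_floor_add_one (D.gap n * N / D.scale + N)
    rw [abs_le]
    constructor <;> rw [grid] <;> linarith
  have hgap : D.gap n = D.scale / N * (D.gap n * N / D.scale) := by
    rcases eq_or_ne D.scale 0 with h | h
    · simpa [h] using abs_gap_le_scale hn
    · field_simp
  have hstep : 0 ≤ D.scale / N := div_nonneg scale_nonneg N.cast_nonneg
  calc |D.gap n - D.scale / N * (D.grid N n - N)|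
      = |D.scale / N * (D.gap n * N / D.scale + N - D.grid N n)| := by
        congr 1
        linear_combination hgap
    _ ≤ D.scale / N := by
        rw [abs_mul, abs_of_nonneg hstep]
        exact mul_le_of_le_one_right hstep hfloor

theorem abs_sum_gap_sub_le {N : ℕ} (hN : N ≠ 0) (i : Fin D.K → Fin D.L) :
    |∑ k, D.gap (D.index i k) - D.scale / N * (D.gridSum N i - D.K * N)| ≤ D.K * D.scale / N := by
  have hsplit : ∑ k, D.gap (D.index i k) - D.scale / N * (D.gridSum N i - D.K * N) =
      ∑ k, (D.gap (D.index i k) - D.scale / N * (D.grid N (D.index i k) - N)) := by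
    simp [gridSum, Finset.sum_sub_distrib, ← Finset.mul_sum]
  rw [hsplit]
  refine (Finset.abs_sum_le_sum_abs _ _).trans
    ((Finset.sum_le_sum fun k _ => abs_gap_sub_le hN (index_mem i k)).trans_eq ?_)
  simp [mul_div_assoc]

theorem norm_sub_ratPoint_y_sq (i : Fin D.K → Fin D.L) (j : Fin 2) :
    ‖ratPoint (fun k => D.x (k * D.L + i k)) - ratPoint (fun k : Fin D.K => D.y j k)‖ ^ 2 =
      ((∑ k, D.dev j (D.index i k) ^ 2 : ℚ) : ℝ) := by
  rw [norm_sub_ratPoint_sq]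
  simp only [dev, index, index_div (i _).2]

namespace IsValid

variable {U : ℕ} (hD : D.IsValid U)
include hD

theorem p_mem_stdSimplex (k : Fin D.K) :
    (fun l : Fin D.L => (D.p (k * D.L + l) : ℝ)) ∈ stdSimplex ℝ (Fin D.L) := by
  refine ⟨fun l => Rat.cast_nonneg.2 (hD.p_nonneg _), ?_⟩
  have := hD.p_sum k k.2
  rw [Finset.sum_range] at this
  beta_reduce
  exact_mod_cast this

theorem sum_weight_mul_norm_sq :
    ∑ i : Fin D.K → Fin D.L, (∏ k, (D.p (k * D.L + i k) : ℝ)) *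
      ‖ratPoint (fun k => D.x (k * D.L + i k)) - ratPoint (fun k : Fin D.K => D.y 1 k)‖ ^ 2 =
      (D.meanCost (D.K * D.L) : ℝ) := by
  simp only [norm_sub_ratPoint_y_sq, Rat.cast_sum, Finset.mul_sum, meanCost, sum_range_mul]
  rw [Finset.sum_comm]
  refine Finset.sum_congr rfl fun k _ => ?_
  simpa [index] using sum_prod_mul_apply (fun k => (hD.p_mem_stdSimplex k).2) k
    fun l => (D.dev 1 (k * D.L + l) : ℝ) ^ 2

theorem transportValue_mem_Icc :
    D.transportValue ∈ Set.Icc 0 ((D.K * D.scale : ℚ) : ℝ) := by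
  have ht : ![(D.t : ℝ), 1 - D.t] ∈ stdSimplex ℝ (Fin 2) := by
    simpa [stdSimplex, Fin.forall_fin_two] using
      And.intro hD.t_nonneg (by exact_mod_cast hD.t_le_one : (D.t : ℝ) ≤ 1)
  have hcost (i : Fin D.K → Fin D.L) (j : Fin 2) :
      ‖ratPoint (fun k => D.x (k * D.L + i k)) - ratPoint (fun k : Fin D.K => D.y j k)‖ ^ 2 ∈
        Set.Icc 0 ((D.K * D.scale : ℚ) : ℝ) := by
    refine ⟨by positivity, ?_⟩
    rw [norm_sub_ratPoint_y_sq, Rat.cast_le]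
    simpa using Finset.sum_le_card_nsmul Finset.univ _ D.scale
      fun k _ => (dev_sq_le_sqSum j _).trans (sqSum_le_scale (index_mem i k))
  rw [transportValue, productTwoPointOT]
  exact optimalTransport_mem_Icc (prod_mem_stdSimplex hD.p_mem_stdSimplex) ht fun i =>
    Fin.forall_fin_two.2 ⟨hcost i 0, hcost i 1⟩

theorem abs_approxValue_sub_le {N : ℕ} (hN : N ≠ 0) :
    |(D.approxValue N : ℝ) - D.transportValue| ≤ ((D.K * D.scale / N : ℚ) : ℝ) := by
  have htrunc : (D.truncSum N (2 * N * D.K) : ℝ) = ∑ s ∈ Finset.range (2 * N * D.K),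
      min (D.t : ℝ) (∑ i : Fin D.K → Fin D.L with D.gridSum N i ≤ s,
        ∏ k, (D.p (k * D.L + i k) : ℝ)) := by
    rw [truncSum, Rat.cast_sum]
    refine Finset.sum_congr rfl fun s hs => ?_
    simp only [cumMass_eq N (Finset.mem_range.1 hs), Nat.lt_add_one_iff, Rat.cast_min,
      Rat.cast_sum, weight, Rat.cast_prod, index]
  have hbound := abs_optimalTransport_two_point_sub_le (M := 2 * N * D.K) (S := D.gridSum N)
    (c := fun u v : EuclideanSpace ℝ (Fin D.K) => ‖u - v‖ ^ 2)
    (x := fun i : Fin D.K → Fin D.L => ratPoint fun k => D.x (k * D.L + i k))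
    (y₁ := ratPoint fun k => D.y 0 k) (y₂ := ratPoint fun k => D.y 1 k)
    (a := (D.scale / N : ℚ)) (b := (D.K * N : ℚ)) (η := (D.K * D.scale / N : ℚ)) (t := D.t)
    (prod_mem_stdSimplex hD.p_mem_stdSimplex)
    ⟨Rat.cast_nonneg.2 hD.t_nonneg, by exact_mod_cast hD.t_le_one⟩ (gridSum_le N)
    (Rat.cast_nonneg.2 (div_nonneg scale_nonneg N.cast_nonneg)) fun i => ?_
  · rw [hD.sum_weight_mul_norm_sq, ← htrunc, abs_sub_comm] at hbound
    rw [transportValue, productTwoPointOT]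
    convert hbound using 3
    rw [approxValue]
    push_cast
    ring
  · rw [norm_sub_ratPoint_y_sq, norm_sub_ratPoint_y_sq, ← Rat.cast_sub, ← Finset.sum_sub_distrib]
    exact_mod_cast abs_sum_gap_sub_le hN i

/-- If all costs are below the tolerance, then `0` is accurate enough. -/
theorem abs_ite_approxValue_sub_le {N : ℕ} (hN : N ≠ 0) (hle : D.K * D.scale / N ≤ D.ε) :
    |((if D.ε < D.K * D.scale then D.approxValue N else 0 : ℚ) : ℝ) - D.transportValue| ≤ D.ε := by
  split_ifs with hlt
  · exact (hD.abs_approxValue_sub_le hN).trans (Rat.cast_le.2 hle)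
  · obtain ⟨hnonneg, hcost⟩ := hD.transportValue_mem_Icc
    rw [Rat.cast_zero, zero_sub, abs_neg, abs_of_nonneg hnonneg]
    exact hcost.trans (Rat.cast_le.2 (not_lt.1 hlt))

end IsValid

end FlatInstance

section Input

open RatRam

theorem dite_finProdFinEquiv_symm {α : Type*} {K L : ℕ} (f : Fin K → Fin L → α) (a : α)
    (k : Fin K) (l : Fin L) :
    (if h : (k * L + l : ℕ) < K * L then
      f (finProdFinEquiv.symm ⟨k * L + l, h⟩).1 (finProdFinEquiv.symm ⟨k * L + l, h⟩).2 else a) =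
      f k l := by
  have hn : (k * L + l : ℕ) = finProdFinEquiv (k, l) := by
    simp [finProdFinEquiv, add_comm, mul_comm]
  have hlt : (k * L + l : ℕ) < K * L := hn.trans_lt (Fin.is_lt _)
  rw [dif_pos hlt, (Fin.ext hn : (⟨k * L + l, hlt⟩ : Fin (K * L)) = _), Equiv.symm_apply_apply]

namespace FlatInstance

variable {K L : ℕ} {p x : Fin K → Fin L → ℚ} {y₁ y₂ : Fin K → ℚ} {t ε : ℚ} {U : ℕ}

variable (p x y₁ y₂ t ε) in
/-- The flat form of an instance of the theorem: the arrays of its initial memory. -/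
def ofInput : FlatInstance where
  K := K
  L := L
  p := (inputState p x y₁ y₂ t ε).arr 0
  x := (inputState p x y₁ y₂ t ε).arr 1
  y j := (inputState p x y₁ y₂ t ε).arr (2 + j)
  t := t
  ε := ε

theorem holds_ofInput : Holds (ofInput p x y₁ y₂ t ε) (inputState p x y₁ y₂ t ε) := by
  constructor <;> first | rfl | exact fun _ => rfl

theorem ofInput_p (k : Fin K) (l : Fin L) : (ofInput p x y₁ y₂ t ε).p (k * L + l) = p k l :=
  dite_finProdFinEquiv_symm p 0 k l

theorem ofInput_x (k : Fin K) (l : Fin L) : (ofInput p x y₁ y₂ t ε).x (k * L + l) = x k l :=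
  dite_finProdFinEquiv_symm x 0 k l

theorem transportValue_ofInput :
    (ofInput p x y₁ y₂ t ε).transportValue = productTwoPointOT p x y₁ y₂ t := by
  have hy (y : Fin K → ℚ) : (fun k : Fin K => if h : (k : ℕ) < K then y ⟨k, h⟩ else 0) = y :=
    funext fun k => dif_pos k.2
  have hp : (fun (k : Fin K) (l : Fin L) => (ofInput p x y₁ y₂ t ε).p (k * L + l)) = p :=
    funext₂ ofInput_p
  have hx : (fun (k : Fin K) (l : Fin L) => (ofInput p x y₁ y₂ t ε).x (k * L + l)) = x :=
    funext₂ ofInput_x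
  change productTwoPointOT (fun (k : Fin K) (l : Fin L) => (ofInput p x y₁ y₂ t ε).p (k * L + l))
    (fun (k : Fin K) (l : Fin L) => (ofInput p x y₁ y₂ t ε).x (k * L + l))
    (fun k : Fin K => if h : (k : ℕ) < K then y₁ ⟨k, h⟩ else 0)
    (fun k : Fin K => if h : (k : ℕ) < K then y₂ ⟨k, h⟩ else 0) t = _
  rw [hp, hx, hy, hy]

theorem isValid_ofInput (hK : 1 ≤ K) (hL : 1 ≤ L) (hp : ∀ k l, 0 ≤ p k l)
    (hp1 : ∀ k, ∑ l, p k l = 1) (ht : 0 ≤ t) (ht1 : t ≤ 1)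
    (hpU : ∀ k l, IsFractionBoundedBy U (p k l)) (hxU : ∀ k l, IsFractionBoundedBy U (x k l))
    (hy₁ : ∀ k, IsFractionBoundedBy U (y₁ k)) (hy₂ : ∀ k, IsFractionBoundedBy U (y₂ k))
    (htU : IsFractionBoundedBy U t) : (ofInput p x y₁ y₂ t ε).IsValid U := by
  have h0 : IsFractionBoundedBy U 0 := .zero htU.one_le
  have hdite {c : Prop} [Decidable c] {P : ℚ → Prop} {f : c → ℚ} (hP : P 0) (hf : ∀ h, P (f h)) :
      P (if h : c then f h else 0) := by
    split_ifs with h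
    exacts [hf h, hP]
  exact
    { K_pos := hK
      L_pos := hL
      p_nonneg := fun n => hdite (P := (0 ≤ ·)) le_rfl fun _ => hp _ _
      p_sum := fun k hk => by
        rw [Finset.sum_range, ← hp1 ⟨k, hk⟩]
        exact Finset.sum_congr rfl fun l _ => ofInput_p ⟨k, hk⟩ l
      t_nonneg := ht
      t_le_one := ht1
      p_bounded := fun n => hdite h0 fun _ => hpU _ _
      x_bounded := fun n => hdite h0 fun _ => hxU _ _
      y_bounded := Fin.forall_fin_two.2
        ⟨fun n => hdite h0 fun _ => hy₁ _, fun n => hdite h0 fun _ => hy₂ _⟩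
      t_bounded := htU }

end FlatInstance

end Input

/-! ### Resource bounds -/

section Complexity

theorem exists_div_two_pow_le {W ε : ℚ} (hε : 0 < ε) :
    ∃ m : ℕ, (∀ j < m, ε < W / 2 ^ j) ∧ W / 2 ^ m ≤ ε ∧ (2 : ℚ) ^ m ≤ max 1 (2 * W / ε) := by
  have hex : ∃ m : ℕ, W / 2 ^ m ≤ ε := by
    obtain ⟨m, hm⟩ := pow_unbounded_of_one_lt (W / ε) (one_lt_two : (1 : ℚ) < 2)
    exact ⟨m, (div_lt_comm₀ hε (by positivity)).1 hm |>.le⟩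
  refine ⟨Nat.find hex, fun j hj => not_le.1 (Nat.find_min hex hj), Nat.find_spec hex, ?_⟩
  rcases hm : Nat.find hex with _ | m
  · simp
  · have hlt := not_le.1 (Nat.find_min hex (m := m) (by omega))
    rw [lt_div_comm₀ hε (by positivity)] at hlt
    rw [pow_succ', mul_div_assoc]
    exact le_max_of_le_right (mul_le_mul_of_nonneg_left hlt.le two_pos.le)

theorem sq_mul_sq_le {K U ε N : ℝ} (hε : 0 < ε) (hlt : ε < 8 * K * U ^ 2) (hN : 0 ≤ N)
    (hNle : N ≤ max 1 (16 * K * U ^ 2 / ε)) :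
    K ^ 2 * N ^ 2 ≤ 16384 * (K ^ 6 * U ^ 8 / ε ^ 4) := by
  set w := K * U ^ 2 / ε with hw
  have hw1 : 1 ≤ 8 * w := by
    rw [hw, ← mul_div_assoc, le_div_iff₀ hε]
    linarith
  have hNw : N ≤ 16 * w := by
    refine hNle.trans (max_le (by linarith) (le_of_eq ?_))
    rw [hw]
    ring
  calc K ^ 2 * N ^ 2 ≤ K ^ 2 * ((16 * w) ^ 2 * (8 * w) ^ 2) := by
        refine mul_le_mul_of_nonneg_left ?_ (sq_nonneg K)
        exact (pow_le_pow_left₀ hN hNw 2).trans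
          (le_mul_of_one_le_right (sq_nonneg _) (one_le_pow₀ hw1))
    _ = 16384 * (K ^ 6 * U ^ 8 / ε ^ 4) := by
        rw [hw]
        ring

theorem le_mul_logb_add_one {n : ℕ} (hn : 1 ≤ n) : (n : ℝ) ≤ n * Real.logb 2 n + 1 := by
  rcases hn.eq_or_lt with rfl | h
  · simp
  · have hlog : 1 ≤ Real.logb 2 (n : ℝ) := by
      rw [Real.le_logb_iff_rpow_le one_lt_two (by positivity), Real.rpow_one]
      exact_mod_cast h
    exact (le_mul_of_one_le_right n.cast_nonneg hlog).trans (le_add_of_nonneg_right zero_le_one)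

theorem natCast_le_of_two_pow_le_max {m : ℕ} {K U ε : ℝ} (hK : 0 < K) (hU : 1 ≤ U) (hε : 0 < ε)
    (hm : (2 : ℝ) ^ m ≤ max 1 (16 * K * U ^ 2 / ε)) :
    (m : ℝ) ≤ max 0 (4 + Real.logb 2 K + 2 * Real.logb 2 U + Real.logb 2 (1 / ε)) := by
  have hlog : Real.logb 2 (16 * K * U ^ 2 / ε) =
      4 + Real.logb 2 K + 2 * Real.logb 2 U + Real.logb 2 (1 / ε) := by
    have h16 : Real.logb 2 16 = 4 := by
      rw [Real.logb_eq_iff_rpow_eq two_pos (by norm_num) (by norm_num)]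
      norm_num
    rw [div_eq_mul_one_div, Real.logb_mul (by positivity) (by positivity),
      Real.logb_mul (by positivity) (by positivity), Real.logb_mul (by positivity) (by positivity),
      Real.logb_pow, h16, Nat.cast_ofNat]
  have hmono := Real.logb_le_logb_of_le one_lt_two (by positivity) hm
  rw [Real.logb_pow, Real.logb_self_eq_one one_lt_two, mul_one] at hmono
  rw [← hlog]
  rcases max_choice 1 (16 * K * U ^ 2 / ε) with h | h <;> rw [h] at hmono
  · exact le_max_of_le_left (hmono.trans_eq Real.logb_one)
  · exact le_max_of_le_right hmono

theorem logb_two_natCast_le (n : ℕ) : Real.logb 2 (n : ℝ) ≤ n := by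
  rcases n.eq_zero_or_pos with rfl | hn
  · simp
  · rw [Real.logb_le_iff_le_rpow one_lt_two (Nat.cast_pos.2 hn), Real.rpow_natCast]
    exact_mod_cast n.lt_two_pow_self.le

theorem clog_le_logb_add_one {n : ℕ} (hn : 1 ≤ n) : (Nat.clog 2 n : ℝ) ≤ Real.logb 2 n + 1 := by
  rw [← Real.natCeil_logb_natCast]
  exact (Nat.ceil_lt_add_one
    (Real.logb_nonneg (by norm_num) (by exact_mod_cast hn))).le

variable {K L U m : ℕ} {W ε : ℚ}

theorem operationCount_le (hK : 1 ≤ K) (hL : 1 ≤ L) (hε : 0 < ε) (hW : W ≤ 8 * K * U ^ 2)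
    (hm : (2 : ℚ) ^ m ≤ max 1 (16 * K * U ^ 2 / ε)) :
    ((K * L * 68 + 12 + if ε < W then 300 * (K * L + K ^ 2 * (2 ^ m) ^ 2) else 0 : ℕ) : ℝ) ≤
      5000000 * ((K : ℝ) * L * Real.logb 2 ((K : ℝ) * L) +
        (K : ℝ) ^ 6 * (U : ℝ) ^ 8 / (ε : ℝ) ^ 4 + 1) := by
  have hKL := le_mul_logb_add_one (Nat.mul_pos hK hL)
  push_cast at hKL ⊢
  have hlog : 0 ≤ (K : ℝ) * L * Real.logb 2 ((K : ℝ) * L) := by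
    refine mul_nonneg (by positivity) (Real.logb_nonneg one_lt_two ?_)
    exact_mod_cast Nat.mul_pos hK hL
  have hε' : (0 : ℝ) < ε := Rat.cast_pos.2 hε
  have hX : 0 ≤ (K : ℝ) ^ 6 * (U : ℝ) ^ 8 / (ε : ℝ) ^ 4 := by positivity
  split_ifs with hlt
  · have := sq_mul_sq_le (K := K) (U := U) hε'
      (by exact_mod_cast hlt.trans_le hW) (by positivity)
      (by exact_mod_cast hm : (2 : ℝ) ^ m ≤ _)
    linarith
  · linarith

theorem bitBound_le (hK : 1 ≤ K) (hU : 1 ≤ U) (hε : 0 < ε)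
    (hm : (2 : ℚ) ^ m ≤ max 1 (16 * K * U ^ 2 / ε)) :
    ((2 * (40 * (K * L * (Nat.clog 2 U + 1) + m)) + 2 : ℕ) : ℝ) ≤
      500 * (1 + (K : ℝ) + L + Real.logb 2 U + max 0 (Real.logb 2 (1 / (ε : ℝ)))) ^ 3 := by
  have hU1 : (1 : ℝ) ≤ U := by exact_mod_cast hU
  have hmR := natCast_le_of_two_pow_le_max (Nat.cast_pos.2 hK) hU1 (Rat.cast_pos.2 hε)
    (by exact_mod_cast hm : (2 : ℝ) ^ m ≤ _)
  have hlogK := logb_two_natCast_le K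
  have hlogU := Real.logb_nonneg one_lt_two hU1
  have hclog := clog_le_logb_add_one hU
  have hmax := le_max_left 0 (Real.logb 2 (1 / (ε : ℝ)))
  have hmax' := le_max_right 0 (Real.logb 2 (1 / (ε : ℝ)))
  have hKL0 : (0 : ℝ) ≤ K ∧ (0 : ℝ) ≤ L := ⟨K.cast_nonneg, L.cast_nonneg⟩
  set Z := 1 + (K : ℝ) + L + Real.logb 2 U + max 0 (Real.logb 2 (1 / (ε : ℝ))) with hZ
  have hZ1 : 1 ≤ Z := by linarith [hKL0.1, hKL0.2]
  have hZ3 : Z ≤ Z ^ 3 := le_self_pow₀ hZ1 (by norm_num)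
  have hmZ : (m : ℝ) ≤ 4 * Z := hmR.trans (max_le (by linarith) (by linarith [hKL0.2, hZ]))
  have hKLZ : (K : ℝ) * L * (Nat.clog 2 U + 1) ≤ Z * Z * (2 * Z) := by
    gcongr <;> linarith [hKL0.1, hKL0.2]
  push_cast
  linarith

theorem FlatInstance.IsValid.mul_scale_le {D : FlatInstance} (hD : D.IsValid U) :
    D.K * D.scale ≤ 8 * D.K * U ^ 2 := by
  rw [mul_assoc, mul_left_comm]
  exact mul_le_mul_of_nonneg_left hD.scale_le D.K.cast_nonneg

theorem FlatInstance.IsValid.exists_resolution {D : FlatInstance} (hD : D.IsValid U)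
    (hε : 0 < D.ε) :
    ∃ m : ℕ, (∀ j < m, D.ε < D.K * D.scale / 2 ^ j) ∧ D.K * D.scale / 2 ^ m ≤ D.ε ∧
      (2 : ℚ) ^ m ≤ max 1 (16 * D.K * U ^ 2 / D.ε) := by
  obtain ⟨m, hlt, hle, hm⟩ := exists_div_two_pow_le (W := D.K * D.scale) hε
  refine ⟨m, hlt, hle, hm.trans (max_le_max_left 1 (div_le_div_of_nonneg_right ?_ hε.le))⟩
  linarith [hD.mul_scale_le]

end Complexity

theorem mainTheorem3 :
    ∃ (P : RatRam.Program) (C B : ℝ) (d : ℕ),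
      ∀ (K L : ℕ), 1 ≤ K → 1 ≤ L →
      ∀ (p x : Fin K → Fin L → ℚ) (y₁ y₂ : Fin K → ℚ) (t ε : ℚ) (U : ℕ),
        (∀ k l, 0 ≤ p k l) → (∀ k, ∑ l, p k l = 1) → 0 ≤ t → t ≤ 1 → 0 < ε →
        (∀ k l, IsFractionBoundedBy U (p k l)) → (∀ k l, IsFractionBoundedBy U (x k l)) →
        (∀ k, IsFractionBoundedBy U (y₁ k)) → (∀ k, IsFractionBoundedBy U (y₂ k)) →
        IsFractionBoundedBy U t → IsFractionBoundedBy U (1 - t) →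
        ∃ (n : ℕ) (T : List ℚ) (s : RatRam.State),
          RatRam.Run P (RatRam.inputState p x y₁ y₂ t ε) n T s ∧
          |(s.output : ℝ) - productTwoPointOT p x y₁ y₂ t| ≤ (ε : ℝ) ∧
          (n : ℝ) ≤ C * ((K : ℝ) * L * Real.logb 2 ((K : ℝ) * L)
            + (K : ℝ) ^ 6 * (U : ℝ) ^ 8 / (ε : ℝ) ^ 4 + 1) ∧
          ∀ q ∈ T, (bitLength q : ℝ) ≤
            B * (1 + (K : ℝ) + L + Real.logb 2 U + max 0 (Real.logb 2 (1 / (ε : ℝ)))) ^ d := by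
  refine ⟨RatRam.transportProgram, 5000000, 500, 3, ?_⟩
  intro K L hK hL p x y₁ y₂ t ε U hp hp1 ht ht1 hε hpU hxU hy₁ hy₂ htU _
  have hD := FlatInstance.isValid_ofInput (ε := ε) hK hL hp hp1 ht ht1 hpU hxU hy₁ hy₂ htU
  obtain ⟨m, hlt, hle, hm⟩ := hD.exists_resolution hε
  obtain ⟨n, hn, T, s, hrun, hT, hout⟩ := RatRam.transportProgram_achieves
    (hD.mono (Nat.le_pow_clog one_lt_two U)) (Nat.le_add_right _ m) hlt hle
    (Nat.le_add_left m _) FlatInstance.holds_ofInput rfl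
  refine ⟨n, T, s, hrun, ?_, ?_, fun q hq => ?_⟩
  · rw [hout, ← FlatInstance.transportValue_ofInput]
    exact hD.abs_ite_approxValue_sub_le (by positivity) (by exact_mod_cast hle)
  · exact (Nat.cast_le.2 hn).trans (operationCount_le hK hL hε hD.mul_scale_le hm)
  · exact (Nat.cast_le.2 (hT q hq).bitLength_le).trans (bitBound_le hK htU.one_le hε hm)
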